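/- **Rectangulations.** A generic rectangulation is a partition of a rectangle into finitely many interior-disjoint axis-aligned rectangles, no four of which have a point in common. Rectangle $r$ is left of $s$ (above $s$) if the right (bottom) side of $r$ meets the left (top) side of $s$ in a segment. Generic rectangulations are considered up to equivalence preserving these relations; $\mathcal R_n$ is the set of those with $n$ rectangles. *Deletion.* For $R\in\mathcal R_n$, $n\ge 2$, $p(R)\in\mathcal R_{n-1}$ is obtained by collapsing the bottom-right rectangle $r$: its top side slides down if the T-joint at the top-left vertex of $r$ has its stem pointing right, and its left side slides to the right if the stem points down. The rectangles of $R$ are numbered $r_1,\dots,r_n$ in reverse order of repeated deletion. *Insertion.* The insertion points of $R$ are: one vertical point on each edge of the left side of each rectangle touching the bottom boundary, sorted by $(x,y)$, followed by one horizontal point on each edge of the top side of each rectangle touching the right boundary, sorted by $(y,x)$; let $\nu(R)$ be their number. For $1\le i\le \nu(R)$, $c_i(R)\in\mathcal R_{n+1}$ is obtained by inserting a new bottom-right rectangle whose top-left corner is the $i$-th insertion point. If that point is vertical, the new rectangle has above it exactly the rectangles to the right of the point that touch the bottom boundary, and to its left exactly the rectangles touching, from the left, the vertical segment through the point below it; the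 horizontal case is the reflection at the main diagonal. *Zigzag sets.* $\mathcal C_1\subseteq\mathcal R_1$ is zigzag if it consists of the one-rectangle rectangulation; $\mathcal C_n\subseteq\mathcal R_n$, $n\ge2$, is zigzag if $\mathcal C_{n-1}:=\{p(R): R\in\mathcal C_n\}$ is zigzag and $c_1(R),c_{\nu(R)}(R)\in\mathcal C_n$ for all $R\in\mathcal C_{n-1}$. *Jumps.* $R'\in\mathcal R_n$ differs from $R\in\mathcal R_n$ by a right (left) jump of $r_j$, $2\le j\le n$, by $d>0$ steps if either $j=n$, $p(R)=p(R')=:P$, $R=c_k(P)$ and $R'=c_{k+d}(P)$ (resp. $R'=c_{k-d}(P)$) for some $k$; or $j<n$, $R$ and $R'$ both have a rectangle forming the whole bottom boundary or both have a rectangle forming the whole right boundary, and $p(R')$ differs from $p(R)$ by such a jump of $r_j$. A jump leading to $R'\in\mathcal C_n$ is minimal w.r.t. $\mathcal C_n$ if no jump of the same rectangle in the same direction by fewer steps leads from $R$ into $\mathcal C_n$. *Patterns.* A wall is a maximal segment of $R$ not lying on the outer boundary. A pattern is a nonempty finite configuration of walls with prescribed directions, incidences (an end vertex of one wall lies in the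 interior of another wall, possibly with the order of several such vertices along a wall) and relative positions (one wall lies to the left of or above another one, meaning that one gets from the former to the latter by repeatedly crossing a rectangle from one side to the opposite side). $R$ contains the pattern if it has pairwise distinct walls with the prescribed directions, incidences and relative positions, and avoids it otherwise. A pattern is tame if, for every $n\ge1$ and every $R\in\mathcal R_n$ avoiding it, $c_1(R)$ and $c_{\nu(R)}(R)$ avoid it. $\mathcal C_n(\mathcal P)$ is the set of $R\in\mathcal C_n$ that avoid all patterns in $\mathcal P$. *Algorithms.* Programs run on a random access machine with unit-cost instructions and an arbitrary fixed data structure representing the current rectangulation in memory. A minimal jump oracle for $\mathcal C_n$ running in time $T$ is a program $\mathrm{next}_{\mathcal C_n}(R,j,d)$ that, whenever $R\in\mathcal C_n$ and $r_j$ can jump in direction $d$ in $R$ (i.e. some jump of $r_j$ in direction $d$ leads from $R$ to an element of $\mathcal R_n$), halts after at most $T$ steps having changed $R$ by a jump of $r_j$ in direction $d$ that is minimal w.r.t. $\mathcal C_n$. Containment of $P\in\mathcal P$ can be tested in time $T$ if there is a program that, whenever $R\in\mathcal C_n$ arises from a rectangulation in $\mathcal C_n(\mathcal P)$ by a jump of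 $r_j$ in direction $d$, halts after at most $T$ steps on $(R,j,d)$, leaves $R$ unchanged, and decides whether $R$ contains $P$. **Theorem.** Let $\mathcal P$ be a finite set of tame rectangulation patterns. There is a constant $c$, depending only on $\mathcal P$, such that the following holds for every $n$ and every zigzag set $\mathcal C_n\subseteq\mathcal R_n$. If $\mathcal C_n$ has a minimal jump oracle $\mathrm{next}_{\mathcal C_n}$ running in time $f_n$, and containment of each $P\in\mathcal P$ can be tested in time $t_n$, then $\mathcal C_n(\mathcal P)$ is a zigzag set, and the program that calls $\mathrm{next}_{\mathcal C_n}(R,j,d)$ once and then again as long as $R$ contains a pattern from $\mathcal P$ (as decided by the given tests) is a minimal jump oracle for $\mathcal C_n(\mathcal P)$ running in time at most $c\cdot n\cdot(f_n+t_n)$. -/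

import Mathlib

namespace GenRect

/-! ## Geometric rectangulations -/

/-- A nondegenerate axis-aligned rectangle in the plane. -/
structure Box where
  x₀ : ℝ
  x₁ : ℝ
  y₀ : ℝ
  y₁ : ℝ
  hx : x₀ < x₁
  hy : y₀ < y₁

/-- The closed rectangle. -/
def Box.closed (B : Box) : Set (ℝ × ℝ) := Set.Icc B.x₀ B.x₁ ×ˢ Set.Icc B.y₀ B.y₁

/-- The interior of the rectangle. -/
def Box.inner (B : Box) : Set (ℝ × ℝ) := Set.Ioo B.x₀ B.x₁ ×ˢ Set.Ioo B.y₀ B.y₁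

/-- `B` is left of `B'`: the right side of `B` meets the left side of `B'` in a segment of
positive length. -/
def Box.LeftOf (B B' : Box) : Prop := B.x₁ = B'.x₀ ∧ max B.y₀ B'.y₀ < min B.y₁ B'.y₁

/-- `B` is above `B'`: the bottom side of `B` meets the top side of `B'` in a segment of
positive length. -/
def Box.AboveOf (B B' : Box) : Prop := B.y₀ = B'.y₁ ∧ max B.x₀ B'.x₀ < min B.x₁ B'.x₁

/-- A (concrete) generic rectangulation: a partition of a rectangle into `n` interior-disjoint
axis-aligned rectangles, no four of which have a point in common. -/
structure Drawing (n : ℕ) where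
  outer : Box
  box : Fin n → Box
  cover : ⋃ i, (box i).closed = outer.closed
  disjoint : ∀ i j, i ≠ j → Disjoint (box i).inner (box j).inner
  generic : ∀ (p : ℝ × ℝ) (s : Finset (Fin n)), (∀ i ∈ s, p ∈ (box i).closed) → s.card ≤ 3

/-- The orientation of an edge or a wall. -/
inductive Orientation
  | vertical
  | horizontal
  deriving DecidableEq

/-- The other orientation. -/
def Orientation.swap : Orientation → Orientation
  | .vertical => .horizontal
  | .horizontal => .vertical

/-- The adjacency relations of a rectangulation whose rectangles are numbered by `Fin n`:
`R .vertical a b` means that `a` is left of `b` (a vertical edge has `a` on its left and `b` on its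
right), and `R .horizontal a b` means that `a` is above `b` (a horizontal edge has `a` above it and
`b` below it).  The pairs `(a, b)` with `R o a b` are in bijection with the edges of orientation `o`
that are not on the outer boundary.  Rectangulations are considered up to equivalence that preserves
these two relations, so such a pair of relations is what a rectangulation up to equivalence is. -/
abbrev Adjacency (n : ℕ) : Type := Orientation → Fin n → Fin n → Prop

/-- The left/right and above/below relations of a concrete rectangulation. -/
def Drawing.adjacency {n : ℕ} (D : Drawing n) : Adjacency n
  | .vertical, a, b => (D.box a).LeftOf (D.box b)
  | .horizontal, a, b => (D.box a).AboveOf (D.box b)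

namespace Adjacency

/-! ## Deletion -/

/-- The wall (or outer side) through the top-left vertex of the last rectangle `r`, i.e. the segment
having that vertex in its interior, has orientation `o`; for a vertical one the T-joint at this
vertex has its stem pointing right (it is the top side of `r`), for a horizontal one it has its stem
pointing down (it is the left side of `r`). For `o = .vertical`, either `r` touches the left
boundary, or some rectangle `a` on the left of `r` is also on the left of some rectangle above `r`. -/
def Through {n : ℕ} (R : Adjacency (n + 1)) (o : Orientation) : Prop :=
  (∀ a, ¬ R o a (Fin.last n)) ∨
    ∃ a s, R o a (Fin.last n) ∧ R o.swap s (Fin.last n) ∧ R o a s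

/-- Deletion `p(R)` of the last rectangle `r`, which is meant to lie in the bottom-right corner.
If the wall through the top-left vertex of `r` is vertical, the top side of `r` slides down to its
bottom side, so that the leftmost rectangle `b` above `r` gets the left neighbors of `r` as
additional left neighbors.  If it is horizontal, the left side of `r` slides to the right, so that
the topmost rectangle `b` left of `r` gets the upper neighbors of `r` as additional upper
neighbors.  All other adjacencies of the remaining rectangles are unchanged. -/
def del {n : ℕ} (R : Adjacency (n + 1)) : Adjacency n := fun o a b =>
  R o a.castSucc b.castSucc ∨
    (R.Through o ∧ R o a.castSucc (Fin.last n) ∧ R o.swap b.castSucc (Fin.last n) ∧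
      ∀ c, R o.swap c (Fin.last n) → ¬ R o c b.castSucc)

/-- The rectangles are numbered in reverse order of deletion: the last rectangle lies in the
bottom-right corner (it has no right and no lower neighbor), and the same holds recursively after
its deletion. -/
def IsNumbered : {n : ℕ} → Adjacency n → Prop
  | 0, _ => True
  | n + 1, R => (∀ o b, ¬ R o (Fin.last n) b) ∧ IsNumbered (del R)

end Adjacency

/-- The set `𝓡 n` of all generic rectangulations with `n` rectangles, up to equivalence.  Numbering
the rectangles in reverse order of deletion picks exactly one numbering for each class. -/
def 𝓡 (n : ℕ) : Set (Adjacency n) :=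
  {R | R.IsNumbered ∧ ∃ D : Drawing n, D.adjacency = R}

namespace Adjacency

/-! ## Insertion -/

/-- Rectangle `a` touches the bottom boundary (`o = .horizontal`) or the right boundary
(`o = .vertical`), i.e. it has no lower, respectively right, neighbor. -/
def Touches {n : ℕ} (R : Adjacency n) (o : Orientation) (a : Fin n) : Prop := ∀ b, ¬ R o a b

/-- `R` is bottom-based: one rectangle forms the entire bottom boundary. -/
def BottomBased {n : ℕ} (R : Adjacency n) : Prop := ∃! a, R.Touches .horizontal a

/-- `R` is right-based: one rectangle forms the entire right boundary. -/
def RightBased {n : ℕ} (R : Adjacency n) : Prop := ∃! a, R.Touches .vertical a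

/-- (A name for) an insertion point.  `(.vertical, r, e)` is a vertical insertion point: a point on
the edge of the left side of `r` whose other side is the rectangle `a` if `e = some a`, and which
lies on the outer boundary if `e = none`.  `(.horizontal, r, e)` is a horizontal insertion point,
on an edge of the top side of `r`. -/
abbrev InsPoint (n : ℕ) : Type := Orientation × Fin n × Option (Fin n)

/-- The names that denote insertion points of `R`: for each rectangle `r` touching the bottom
boundary one point for each edge of the left side of `r`, and for each rectangle `r` touching the
right boundary one point for each edge of the top side of `r`. -/
def IsInsPoint {n : ℕ} (R : Adjacency n) : InsPoint n → Prop
  | (o, r, none) => R.Touches o.swap r ∧ ∀ a, ¬ R o a r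
  | (o, r, some a) => R.Touches o.swap r ∧ R o a r

/-- The linear order of insertion points: vertical ones sorted by the `(x, y)`-coordinates, followed
by the horizontal ones sorted by the `(y, x)`-coordinates.  The numbering of the rectangles
increases to the right along the bottom boundary and along the top side of a rectangle, and
decreases upwards along the right boundary and along the left side of a rectangle. -/
def Before {n : ℕ} : InsPoint n → InsPoint n → Prop
  | (.vertical, r, e), (.vertical, r', e') =>
      r < r' ∨ (r = r' ∧ ∃ a ∈ e, ∃ a' ∈ e', a' < a)
  | (.vertical, _, _), (.horizontal, _, _) => True
  | (.horizontal, _, _), (.vertical, _, _) => False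
  | (.horizontal, r, e), (.horizontal, r', e') =>
      r' < r ∨ (r = r' ∧ ∃ a ∈ e, ∃ a' ∈ e', a < a')

/-- The number `ν(R)` of insertion points. -/
noncomputable def nu {n : ℕ} (R : Adjacency n) : ℕ := {q | R.IsInsPoint q}.ncard

/-- `q` is the `k`-th insertion point of `R`, where `1 ≤ k ≤ ν(R)`. -/
def IsNthInsPoint {n : ℕ} (R : Adjacency n) (k : ℕ) (q : InsPoint n) : Prop :=
  R.IsInsPoint q ∧ {q' | R.IsInsPoint q' ∧ Before q' q}.ncard + 1 = k

/-- Insertion of a new last rectangle at the insertion point `(o, r, e)`.  For `o = .vertical`, the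
new rectangle has above it exactly the rectangles from `r` on to the right that touch the bottom
boundary, and on its left exactly the left neighbors of `r` that reach below the insertion point;
those of them that lie entirely below it are no longer left neighbors of `r`, and all other
adjacencies are unchanged.  For `o = .horizontal`, reflect this at the main diagonal. -/
def ins {n : ℕ} (R : Adjacency n) : InsPoint n → Adjacency (n + 1)
  | (o, r, e) => fun o' a b =>
    (∃ a' b' : Fin n, a = a'.castSucc ∧ b = b'.castSucc ∧ R o' a' b' ∧
      ¬ (o' = o ∧ b' = r ∧ ∃ a₀ ∈ e, a₀ < a')) ∨
    (∃ a' : Fin n, a = a'.castSucc ∧ b = Fin.last n ∧ o' = o ∧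
      R o a' r ∧ ∃ a₀ ∈ e, a₀ ≤ a') ∨
    (∃ a' : Fin n, a = a'.castSucc ∧ b = Fin.last n ∧ o' = o.swap ∧
      R.Touches o.swap a' ∧ r ≤ a')

/-- `S = c_k(R)`: `S` is obtained from `R` by insertion at the `k`-th insertion point. -/
def IsChild {n : ℕ} (R : Adjacency n) (k : ℕ) (S : Adjacency (n + 1)) : Prop :=
  ∃ q, R.IsNthInsPoint k q ∧ S = R.ins q

end Adjacency

/-! ## Zigzag sets and jumps -/

/-- The rectangulation consisting of a single rectangle. -/
def square : Adjacency 1 := fun _ _ _ => False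

/-- Zigzag sets of generic rectangulations with `n` rectangles (`n ≥ 1`). -/
def IsZigzag : {n : ℕ} → Set (Adjacency n) → Prop
  | 0, _ => False
  | 1, C => C = {square}
  | n + 2, C => C ⊆ 𝓡 (n + 2) ∧ IsZigzag (Adjacency.del '' C) ∧
      ∀ R ∈ (Adjacency.del '' C : Set (Adjacency (n + 1))),
        (∃ S ∈ C, R.IsChild 1 S) ∧ (∃ S ∈ C, R.IsChild R.nu S)

/-- Jump directions. -/
inductive Dir
  | left
  | right

/-- `R'` differs from `R` by a jump of the `j`-th rectangle (`2 ≤ j ≤ n`) by `d` steps to the right,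
respectively to the left. -/
def IsJump (dir : Dir) (j d : ℕ) : {n : ℕ} → Adjacency n → Adjacency n → Prop
  | 0, _, _ => False
  | n + 1, R, R' =>
      (j = n + 1 ∧ 2 ≤ j ∧ 0 < d ∧ R.del = R'.del ∧
        ∃ k k' : ℕ, R.del.IsChild k R ∧ R.del.IsChild k' R' ∧
          match dir with
          | .right => k' = k + d
          | .left => k = k' + d) ∨
      (j < n + 1 ∧ ((R.BottomBased ∧ R'.BottomBased) ∨ (R.RightBased ∧ R'.RightBased)) ∧
        IsJump dir j d R.del R'.del)

/-- `R'` is obtained from `R` by a jump of the `j`-th rectangle in direction `dir` that is minimal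
w.r.t. `C`: it leads into `C`, and no jump of the same rectangle in the same direction by fewer steps
leads into `C`. -/
def IsMinimalJump {n : ℕ} (C : Set (Adjacency n)) (dir : Dir) (j : ℕ) (R R' : Adjacency n) : Prop :=
  R' ∈ C ∧ ∃ d, IsJump dir j d R R' ∧ ∀ d' < d, ∀ R'' ∈ C, ¬ IsJump dir j d' R R''

/-- The `j`-th rectangle of `R` can jump in direction `dir` at all, i.e. a jump of it in this
direction leads to some generic rectangulation. -/
def CanJump {n : ℕ} (dir : Dir) (j : ℕ) (R : Adjacency n) : Prop :=
  ∃ d, ∃ R' ∈ 𝓡 n, IsJump dir j d R R'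

/-! ## Walls and patterns -/

namespace Adjacency

/-- The edge `f` (of orientation `o`) directly follows the edge `e` on a common wall, to the right of
it if the wall is horizontal and below it if the wall is vertical.  The vertex between the two edges
is a T-joint: the two edges have the same rectangle on one side, and on the other side two
rectangles that are separated by the stem of the T-joint. -/
def Next {n : ℕ} (R : Adjacency n) (o : Orientation) (e f : Fin n × Fin n) : Prop :=
  R o e.1 e.2 ∧ R o f.1 f.2 ∧
    ((e.2 = f.2 ∧ R o.swap e.1 f.1) ∨ (e.1 = f.1 ∧ R o.swap e.2 f.2))

/-- `W` is (the set of edges of) a wall of orientation `o`. -/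
def IsWall {n : ℕ} (R : Adjacency n) (o : Orientation) (W : Set (Fin n × Fin n)) : Prop :=
  ∃ e, R o e.1 e.2 ∧ W = {f | Relation.EqvGen (R.Next o) e f}

end Adjacency

/-- The two end vertices of a wall: the first one is the left one (top one), the last one is the
right one (bottom one) for a horizontal (vertical) wall. -/
inductive End
  | first
  | last

namespace Adjacency

/-- The given end vertex of the wall `W` of orientation `o` is the vertex between the consecutive
edges `e` and `f` of a wall of the other orientation. -/
def EndsBetween {n : ℕ} (R : Adjacency n) (o : Orientation) (W : Set (Fin n × Fin n)) :
    End → Fin n × Fin n → Fin n × Fin n → Prop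
  | .first, e, f => R o.swap e.1 e.2 ∧ R o.swap f.1 f.2 ∧ e.1 = f.1 ∧ (e.2, f.2) ∈ W
  | .last, e, f => R o.swap e.1 e.2 ∧ R o.swap f.1 f.2 ∧ e.2 = f.2 ∧ (e.1, f.1) ∈ W

/-- Of two walls of orientation `o`, the wall `W` precedes `W'`: it lies to the left of it (vertical
walls), respectively above it (horizontal walls), in the transitive sense that one gets from `W` to
`W'` by repeatedly crossing a rectangle from one side to the opposite one. -/
def WallPrecedes {n : ℕ} (R : Adjacency n) (o : Orientation) (W W' : Set (Fin n × Fin n)) : Prop :=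
  Relation.TransGen
    (fun V V' => R.IsWall o V ∧ R.IsWall o V' ∧ ∃ a b c, (a, b) ∈ V ∧ (b, c) ∈ V') W W'

end Adjacency

/-- A rectangulation pattern: a nonempty finite configuration of walls with prescribed directions,
incidences and relative positions.
* `ori w` is the orientation of wall `w`;
* `inc w x v`: the end vertex `x` of `w` lies in the interior of wall `v`;
* `ord v w x w' x'`: the end vertices `x` of `w` and `x'` of `w'` lie in the interior of wall `v`,
  the first one before the second one (to the left of it or above it);
* `pos w w'`: wall `w` lies to the left of, respectively above, the wall `w'` of the same
  orientation. -/
structure Pattern where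
  size : ℕ
  size_pos : 0 < size
  ori : Fin size → Orientation
  inc : Fin size → End → Fin size → Prop
  ord : Fin size → Fin size → End → Fin size → End → Prop
  pos : Fin size → Fin size → Prop

/-- `R` contains the pattern `P`: there are pairwise distinct walls of `R` with the directions,
incidences and relative positions that `P` prescribes. -/
def Contains {n : ℕ} (R : Adjacency n) (P : Pattern) : Prop :=
  ∃ φ : Fin P.size → Set (Fin n × Fin n),
    (∀ w, R.IsWall (P.ori w) (φ w)) ∧
    (∀ w w', P.ori w = P.ori w' → φ w = φ w' → w = w') ∧
    (∀ w x v, P.inc w x v →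
      P.ori v = (P.ori w).swap ∧
      ∃ e ∈ φ v, ∃ f ∈ φ v, R.EndsBetween (P.ori w) (φ w) x e f) ∧
    (∀ v w x w' x', P.ord v w x w' x' →
      P.ori v = (P.ori w).swap ∧ P.ori v = (P.ori w').swap ∧
      ∃ e ∈ φ v, ∃ f ∈ φ v, ∃ e' ∈ φ v, ∃ f' ∈ φ v,
        R.EndsBetween (P.ori w) (φ w) x e f ∧ R.EndsBetween (P.ori w') (φ w') x' e' f' ∧
        Relation.TransGen (R.Next (P.ori v)) e e') ∧
    (∀ w w', P.pos w w' →
      P.ori w = P.ori w' ∧ R.WallPrecedes (P.ori w) (φ w) (φ w'))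

/-- `R` avoids all patterns from `𝒬`. -/
def AvoidsAll {n : ℕ} (𝒬 : Finset Pattern) (R : Adjacency n) : Prop := ∀ P ∈ 𝒬, ¬ Contains R P

/-- `C(𝒬)`: the rectangulations from `C` that avoid all patterns from `𝒬`. -/
def avoiders {n : ℕ} (C : Set (Adjacency n)) (𝒬 : Finset Pattern) : Set (Adjacency n) :=
  {R ∈ C | AvoidsAll 𝒬 R}

/-- A pattern is tame if inserting a rectangle below or to the right of a rectangulation that avoids
the pattern never creates it. -/
def Tame (P : Pattern) : Prop :=
  ∀ n ≥ 1, ∀ R ∈ 𝓡 n, ¬ Contains R P →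
    (∀ S, R.IsChild 1 S → ¬ Contains S P) ∧ (∀ S, R.IsChild R.nu S → ¬ Contains S P)

/-! ## Programs and running times

Programs for a random access machine with registers and a memory ("heap") of natural numbers, with
unit cost for each executed instruction. -/

/-- The state of the machine. -/
structure State where
  reg : ℕ → ℕ
  heap : ℕ → ℕ

/-- Programs.  They may read the two parameters `j` (a rectangle number) and `d` (a direction) of the
current procedure call, which are passed by value. -/
inductive Prog
  /-- Do nothing. -/
  | skip : Prog
  /-- `reg r := c` -/
  | const (r c : ℕ) : Prog
  /-- `reg r := j` -/
  | getIndex (r : ℕ) : Prog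
  /-- `reg r := d`, where left is `0` and right is `1` -/
  | getDir (r : ℕ) : Prog
  /-- `reg r := reg s + reg t` -/
  | add (r s t : ℕ) : Prog
  /-- `reg r := reg s - reg t` (truncated) -/
  | sub (r s t : ℕ) : Prog
  /-- `reg r := heap (reg s)` -/
  | load (r s : ℕ) : Prog
  /-- `heap (reg r) := reg s` -/
  | store (r s : ℕ) : Prog
  /-- first `p`, then `q` -/
  | seq (p q : Prog) : Prog
  /-- if `reg r ≠ 0` then `p` else `q` -/
  | ite (r : ℕ) (p q : Prog) : Prog
  /-- while `reg r ≠ 0` do `p` -/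
  | while (r : ℕ) (p : Prog) : Prog

/-- The number that encodes a direction. -/
def Dir.code : Dir → ℕ
  | .left => 0
  | .right => 1

/-- `Exec j d p σ σ' k`: with parameters `j` and `d`, program `p` started in state `σ` halts in state
`σ'` after exactly `k` steps; each basic instruction and each test of a condition is one step. -/
inductive Exec (j : ℕ) (d : Dir) : Prog → State → State → ℕ → Prop
  | skip (σ) : Exec j d .skip σ σ 1
  | const (r c σ) : Exec j d (.const r c) σ ⟨Function.update σ.reg r c, σ.heap⟩ 1
  | getIndex (r σ) : Exec j d (.getIndex r) σ ⟨Function.update σ.reg r j, σ.heap⟩ 1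
  | getDir (r σ) : Exec j d (.getDir r) σ ⟨Function.update σ.reg r d.code, σ.heap⟩ 1
  | add (r s t σ) :
      Exec j d (.add r s t) σ ⟨Function.update σ.reg r (σ.reg s + σ.reg t), σ.heap⟩ 1
  | sub (r s t σ) :
      Exec j d (.sub r s t) σ ⟨Function.update σ.reg r (σ.reg s - σ.reg t), σ.heap⟩ 1
  | load (r s σ) :
      Exec j d (.load r s) σ ⟨Function.update σ.reg r (σ.heap (σ.reg s)), σ.heap⟩ 1
  | store (r s σ) :
      Exec j d (.store r s) σ ⟨σ.reg, Function.update σ.heap (σ.reg r) (σ.reg s)⟩ 1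
  | seq {p q σ₁ σ₂ σ₃ k l} : Exec j d p σ₁ σ₂ k → Exec j d q σ₂ σ₃ l →
      Exec j d (.seq p q) σ₁ σ₃ (k + l)
  | ite_true {r p q σ σ' k} : σ.reg r ≠ 0 → Exec j d p σ σ' k →
      Exec j d (.ite r p q) σ σ' (k + 1)
  | ite_false {r p q σ σ' k} : σ.reg r = 0 → Exec j d q σ σ' k →
      Exec j d (.ite r p q) σ σ' (k + 1)
  | while_true {r p σ₁ σ₂ σ₃ k l} : σ₁.reg r ≠ 0 → Exec j d p σ₁ σ₂ k →
      Exec j d (.while r p) σ₂ σ₃ l → Exec j d (.while r p) σ₁ σ₃ (k + l + 1)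
  | while_false {r p σ} : σ.reg r = 0 → Exec j d (.while r p) σ σ 1

/-- A data structure for rectangulations with `n` rectangles: for each rectangulation the set of heap
contents that represent it. -/
abbrev DataStructure (n : ℕ) : Type := Adjacency n → Set (ℕ → ℕ)

/-- `p` is a minimal jump oracle for `C` that runs in time `T`, w.r.t. the data structure `enc`: in
every call with parameters `j`, `dir` where the heap represents a rectangulation `R` from `C` whose
`j`-th rectangle can jump in direction `dir`, it halts after at most `T` steps, having modified `R`
by a jump of the `j`-th rectangle in direction `dir` that is minimal w.r.t. `C`. -/
def IsMinimalJumpOracle {n : ℕ} (enc : DataStructure n) (C : Set (Adjacency n)) (p : Prog)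
    (T : ℕ) : Prop :=
  ∀ R ∈ C, ∀ (j : ℕ) (dir : Dir), CanJump dir j R →
    ∀ σ : State, σ.heap ∈ enc R →
      ∃ (σ' : State) (k : ℕ), Exec j dir p σ σ' k ∧ k ≤ T ∧
        ∃ R', IsMinimalJump C dir j R R' ∧ σ'.heap ∈ enc R'

/-- `p` tests containment of `P` in time `T`, for use in the class `C(𝒬)`: whenever the heap
represents a rectangulation `R ∈ C` that arises by a jump of the `j`-th rectangle in direction `dir`
from a rectangulation in `C(𝒬)`, the call with parameters `j`, `dir` halts after at most `T` steps,
the heap still represents `R`, and register `0` is nonzero if and only if `R` contains `P`.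
(A program that tests containment in arbitrary rectangulations is in particular such a test.) -/
def IsContainmentTest {n : ℕ} (enc : DataStructure n) (C : Set (Adjacency n)) (𝒬 : Finset Pattern)
    (P : Pattern) (p : Prog) (T : ℕ) : Prop :=
  ∀ R ∈ C, ∀ (j : ℕ) (dir : Dir), (∃ R₀ ∈ avoiders C 𝒬, ∃ d, IsJump dir j d R₀ R) →
    ∀ σ : State, σ.heap ∈ enc R →
      ∃ (σ' : State) (k : ℕ), Exec j dir p σ σ' k ∧ k ≤ T ∧
        σ'.heap ∈ enc R ∧ (σ'.reg 0 ≠ 0 ↔ Contains R P)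

/-- Run the given tests one after the other until one of them succeeds; afterwards register `0` is
nonzero if and only if one of them has succeeded. -/
def testAny : List Prog → Prog
  | [] => .const 0 0
  | T :: Ts => .seq T (.ite 0 .skip (testAny Ts))

/-- The minimal jump oracle for the avoiding class: call the oracle `base`, and repeat this as long
as one of the containment tests succeeds on the resulting rectangulation. -/
def nextJumpAvoiding (base : Prog) (tests : List Prog) : Prog :=
  .seq base (.seq (testAny tests) (.while 0 (.seq base (testAny tests))))

end GenRect

open GenRect

namespace GenRect

/-! The zigzag property needs avoidance to pass both ways between a rectangulation and its parent.
Downwards, inserting a rectangle splits at most one edge and never merges walls, so every pattern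
contained in the parent survives (`contains_ins`); since every rectangulation is an insertion into
its parent (`exists_eq_ins`), deletion preserves avoidance. Upwards, tameness says that the two
corner insertions preserve avoidance. Together these give `del_image_avoiders`: deletion commutes
with passing to avoiders, and `isZigzag_avoiders` follows by induction.

For the oracle, fix an avoiding start `R`, a rectangle and a direction. Jumps behave like moves
along a line: step counts add (`IsJump.trans`), subtract (`IsJump.sub`), determine the target within
the zigzag set (`IsJump.unique`), and are at most `2 * n` (`IsJump.le`). For the last rectangle this
is arithmetic of insertion indices. For an earlier rectangle it is inherited from the parents,
because a bottom-based or right-based rectangulation is exactly a corner child. Repeated minimal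
jumps therefore visit all members of the zigzag set on this line in order, and the first avoider met
is a minimal target.

The loop cannot get stuck (`IsJump.exists_next`). If the current member contains a pattern although
the parent avoids all of them, it is not a corner child by tameness, so the corner child in the jump
direction still lies ahead, and it belongs to the zigzag set. As each jump advances by at least one
step, there are linearly many iterations, each costing one oracle call and at most one run of every
test.

The combinatorial lemmas are derived from coordinates (`Layout`), with one statement for both
orientations: `o.swap` is reflection at the main diagonal. Neighbors are found by asking which
rectangle covers the points just beside a vertex. -/

@[simp] theorem Orientation.swap_swap (o : Orientation) : o.swap.swap = o := by cases o <;> rfl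

@[simp] theorem Orientation.swap_ne (o : Orientation) : o.swap ≠ o := by
  cases o <;> simp [Orientation.swap]

@[simp] theorem Orientation.ne_swap (o : Orientation) : o ≠ o.swap := (Orientation.swap_ne o).symm

theorem Orientation.eq_or_eq_swap (o o' : Orientation) : o' = o ∨ o' = o.swap := by
  cases o <;> cases o' <;> simp [Orientation.swap]

theorem Orientation.forall_iff {p : Orientation → Prop} (o : Orientation) :
    (∀ o', p o') ↔ p o ∧ p o.swap := by
  refine ⟨fun h => ⟨h _, h _⟩, fun h o' => ?_⟩
  rcases Orientation.eq_or_eq_swap o o' with rfl | rfl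
  exacts [h.1, h.2]

/-- Coordinates realizing an adjacency structure, treated uniformly in the two orientations: `lo o`
and `hi o` are the bounds of the rectangles in the direction in which edges of orientation `o` are
crossed, with the origin in the top left corner. -/
structure Layout {n : ℕ} (R : Adjacency n) where
  lo : Orientation → Fin n → ℝ
  hi : Orientation → Fin n → ℝ
  Lo : Orientation → ℝ
  Hi : Orientation → ℝ
  lt : ∀ o i, lo o i < hi o i
  Lo_le : ∀ o i, Lo o ≤ lo o i
  le_Hi : ∀ o i, hi o i ≤ Hi o
  adj : ∀ o a b, R o a b ↔
    hi o a = lo o b ∧ lo o.swap a < hi o.swap b ∧ lo o.swap b < hi o.swap a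
  sep : ∀ i j, i ≠ j → ∃ o, hi o i ≤ lo o j ∨ hi o j ≤ lo o i
  cover : ∀ p : Orientation → ℝ, (∀ o, Lo o ≤ p o ∧ p o ≤ Hi o) →
    ∃ i, ∀ o, lo o i ≤ p o ∧ p o ≤ hi o i
  generic : ∀ (p : Orientation → ℝ) (s : Finset (Fin n)),
    (∀ i ∈ s, ∀ o, lo o i ≤ p o ∧ p o ≤ hi o i) → s.card ≤ 3

theorem Box.closed_subset_closed {B B' : Box} (h : B.closed ⊆ B'.closed) :
    B'.x₀ ≤ B.x₀ ∧ B.x₁ ≤ B'.x₁ ∧ B'.y₀ ≤ B.y₀ ∧ B.y₁ ≤ B'.y₁ := by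
  have h₁ : (B.x₀, B.y₀) ∈ B.closed := ⟨⟨le_rfl, B.hx.le⟩, ⟨le_rfl, B.hy.le⟩⟩
  have h₂ : (B.x₁, B.y₁) ∈ B.closed := ⟨⟨B.hx.le, le_rfl⟩, ⟨B.hy.le, le_rfl⟩⟩
  exact ⟨(h h₁).1.1, (h h₂).1.2, (h h₁).2.1, (h h₂).2.2⟩

theorem Drawing.nonempty_layout {n : ℕ} (D : Drawing n) : Nonempty (Layout D.adjacency) := by
  have hsub (i) : (D.box i).closed ⊆ D.outer.closed := by
    rw [← D.cover]; exact Set.subset_iUnion (fun i => (D.box i).closed) i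
  refine ⟨{
    -- Negating the second coordinate puts the origin at the top left, so that reflection at the
    -- main diagonal merely exchanges the two orientations.
    lo := fun o i => match o with | .vertical => (D.box i).x₀ | .horizontal => -(D.box i).y₁
    hi := fun o i => match o with | .vertical => (D.box i).x₁ | .horizontal => -(D.box i).y₀
    Lo := fun o => match o with | .vertical => D.outer.x₀ | .horizontal => -D.outer.y₁
    Hi := fun o => match o with | .vertical => D.outer.x₁ | .horizontal => -D.outer.y₀
    lt := ?_, Lo_le := ?_, le_Hi := ?_, adj := ?_, sep := ?_, cover := ?_, generic := ?_ }⟩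
  · rintro (_ | _) i
    · exact (D.box i).hx
    · exact neg_lt_neg (D.box i).hy
  · have h i := Box.closed_subset_closed (hsub i)
    rintro (_ | _) i
    · exact (h i).1
    · exact neg_le_neg (h i).2.2.2
  · have h i := Box.closed_subset_closed (hsub i)
    rintro (_ | _) i
    · exact (h i).2.1
    · exact neg_le_neg (h i).2.2.1
  · have hx i := (D.box i).hx
    have hy i := (D.box i).hy
    rintro (_ | _) a b
    · simp only [Drawing.adjacency, Box.LeftOf, Orientation.swap, max_lt_iff, lt_min_iff,
        neg_lt_neg_iff]
      have := hy a; have := hy b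
      tauto
    · simp only [Drawing.adjacency, Box.AboveOf, Orientation.swap, max_lt_iff, lt_min_iff,
        neg_inj]
      have := hx a; have := hx b
      tauto
  · intro i j hij
    -- If neither direction separates the two boxes, their open projections overlap in both
    -- directions, which gives a common interior point.
    by_contra! h
    have h₁ := h .vertical
    have h₂ := h .horizontal
    simp only [neg_lt_neg_iff] at h₁ h₂
    obtain ⟨x, hx, hx'⟩ := exists_between (a₁ := max (D.box i).x₀ (D.box j).x₀)
      (a₂ := min (D.box i).x₁ (D.box j).x₁) (by
        simp only [max_lt_iff, lt_min_iff]
        exact ⟨⟨(D.box i).hx, h₁.1⟩, ⟨h₁.2, (D.box j).hx⟩⟩)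
    obtain ⟨y, hy, hy'⟩ := exists_between (a₁ := max (D.box i).y₀ (D.box j).y₀)
      (a₂ := min (D.box i).y₁ (D.box j).y₁) (by
        simp only [max_lt_iff, lt_min_iff]
        exact ⟨⟨(D.box i).hy, h₂.2⟩, ⟨h₂.1, (D.box j).hy⟩⟩)
    simp only [max_lt_iff, lt_min_iff] at hx hx' hy hy'
    exact Set.disjoint_left.1 (D.disjoint i j hij)
      (show (x, y) ∈ _ from ⟨⟨hx.1, hx'.1⟩, ⟨hy.1, hy'.1⟩⟩) ⟨⟨hx.2, hx'.2⟩, ⟨hy.2, hy'.2⟩⟩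
  · intro p hp
    have h₁ := hp .vertical
    have h₂ := hp .horizontal
    have : (p .vertical, -p .horizontal) ∈ ⋃ i, (D.box i).closed := by
      rw [D.cover]
      exact ⟨⟨h₁.1, h₁.2⟩, ⟨by linarith [h₂.2], by linarith [h₂.1]⟩⟩
    obtain ⟨i, hi⟩ := Set.mem_iUnion.1 this
    refine ⟨i, ?_⟩
    rintro (_ | _)
    · exact hi.1
    · have := hi.2
      simp only [Set.mem_Icc] at this
      exact ⟨by linarith [this.2], by linarith [this.1]⟩
  · intro p s hs
    refine D.generic (p .vertical, -p .horizontal) s fun i hi => ?_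
    have h₁ := hs i hi .vertical
    have h₂ := hs i hi .horizontal
    exact ⟨⟨h₁.1, h₁.2⟩, ⟨by linarith [h₂.2], by linarith [h₂.1]⟩⟩

theorem nonempty_layout_of_mem {n : ℕ} {R : Adjacency n} (hR : R ∈ 𝓡 n) : Nonempty (Layout R) := by
  obtain ⟨-, D, rfl⟩ := hR
  exact D.nonempty_layout

/-- The last rectangle has no right or lower neighbor, and deletion keeps all adjacencies among the
others, so induction applies. This is the source of all comparisons between numbers and positions.
-/
theorem Adjacency.IsNumbered.lt {n : ℕ} {R : Adjacency n} (hR : R.IsNumbered) {o : Orientation}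
    {a b : Fin n} (h : R o a b) : a < b := by
  induction n with
  | zero => exact a.elim0
  | succ n ih =>
    obtain ⟨h₁, h₂⟩ := hR
    induction a using Fin.lastCases with
    | last => exact absurd h (h₁ _ _)
    | cast a =>
      induction b using Fin.lastCases with
      | last => exact Fin.castSucc_lt_last a
      | cast b => exact Fin.castSucc_lt_castSucc_iff.2 (ih h₂ (Or.inl h))

/-- Provides a point so close to `x` that none of finitely many coordinates lies in between; it
stands for all points directly before `x`. -/
theorem exists_lt_above_finite {ι : Type*} [Finite ι] (v : ι → ℝ) (x : ℝ) :
    ∃ x' < x, ∀ i, v i < x → v i < x' := by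
  have h : ∀ᶠ x' in nhdsWithin x (Set.Iio x), ∀ i, v i < x → v i < x' := by
    refine Filter.eventually_all.2 fun i => ?_
    by_cases hi : v i < x
    · filter_upwards [Ioo_mem_nhdsLT hi] with x' hx' _ using hx'.1
    · exact Filter.Eventually.of_forall fun _ h => absurd h hi
  obtain ⟨x', h₁, h₂⟩ := (h.and self_mem_nhdsWithin).exists
  exact ⟨x', h₂, h₁⟩

theorem exists_gt_below_finite {ι : Type*} [Finite ι] (v : ι → ℝ) (x : ℝ) :
    ∃ x' > x, ∀ i, x < v i → x' < v i := by
  obtain ⟨x', h, h'⟩ := exists_lt_above_finite (fun i => -v i) (-x)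
  exact ⟨-x', by linarith, fun i hi => by linarith [h' i (by linarith)]⟩

/-! ### Geometry of a layout: neighbors, contact with the boundary, and the numbering -/

namespace Layout

variable {n : ℕ} {R : Adjacency n} (D : Layout R)

theorem cover' (o : Orientation) (x y : ℝ) (hx : D.Lo o ≤ x ∧ x ≤ D.Hi o)
    (hy : D.Lo o.swap ≤ y ∧ y ≤ D.Hi o.swap) :
    ∃ i, (D.lo o i ≤ x ∧ x ≤ D.hi o i) ∧ (D.lo o.swap i ≤ y ∧ y ≤ D.hi o.swap i) := by
  obtain ⟨i, hi⟩ := D.cover (fun o' => if o' = o then x else y)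
    ((Orientation.forall_iff o).2 (by simpa using ⟨hx, hy⟩))
  exact ⟨i, by simpa using (Orientation.forall_iff o).1 hi⟩

theorem exists_before (o : Orientation) {x : ℝ} (h₁ : D.Lo o < x) (h₂ : x ≤ D.Hi o) :
    ∃ x', (D.Lo o ≤ x' ∧ x' ≤ D.Hi o) ∧
      ∀ i, D.lo o i ≤ x' ∧ x' ≤ D.hi o i → D.lo o i < x ∧ x ≤ D.hi o i := by
  -- Including the outer bound among the values to be avoided keeps `x'` inside the outer rectangle.
  obtain ⟨x', hx', h⟩ := exists_lt_above_finite
    (Sum.elim (fun _ : Unit => D.Lo o) (D.hi o)) x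
  refine ⟨x', ⟨(h (.inl ()) h₁).le, hx'.le.trans h₂⟩, fun i hi => ⟨hi.1.trans_lt hx', ?_⟩⟩
  by_contra! hlt
  exact absurd (h (.inr i) hlt) hi.2.not_gt

theorem exists_after (o : Orientation) {x : ℝ} (h₁ : D.Lo o ≤ x) (h₂ : x < D.Hi o) :
    ∃ x', (D.Lo o ≤ x' ∧ x' ≤ D.Hi o) ∧
      ∀ i, D.lo o i ≤ x' ∧ x' ≤ D.hi o i → D.lo o i ≤ x ∧ x < D.hi o i := by
  obtain ⟨x', hx', h⟩ := exists_gt_below_finite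
    (Sum.elim (fun _ : Unit => D.Hi o) (D.lo o)) x
  refine ⟨x', ⟨h₁.trans hx'.le, (h (.inl ()) h₂).le⟩, fun i hi => ⟨?_, hx'.trans_le hi.2⟩⟩
  by_contra! hlt
  exact absurd (h (.inr i) hlt) hi.1.not_gt

/-- Some rectangle contains all points directly before `x` and directly before `y`. -/
theorem germ_mm (o : Orientation) {x y : ℝ} (h₁ : D.Lo o < x) (h₂ : x ≤ D.Hi o)
    (h₃ : D.Lo o.swap < y) (h₄ : y ≤ D.Hi o.swap) :
    ∃ i, (D.lo o i < x ∧ x ≤ D.hi o i) ∧ (D.lo o.swap i < y ∧ y ≤ D.hi o.swap i) := by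
  obtain ⟨x', hx', hx⟩ := D.exists_before o h₁ h₂
  obtain ⟨y', hy', hy⟩ := D.exists_before o.swap h₃ h₄
  obtain ⟨i, hi⟩ := D.cover' o x' y' hx' hy'
  exact ⟨i, hx i hi.1, hy i hi.2⟩

/-- Some rectangle contains all points directly before `x` and directly after `y`. -/
theorem germ_mp (o : Orientation) {x y : ℝ} (h₁ : D.Lo o < x) (h₂ : x ≤ D.Hi o)
    (h₃ : D.Lo o.swap ≤ y) (h₄ : y < D.Hi o.swap) :
    ∃ i, (D.lo o i < x ∧ x ≤ D.hi o i) ∧ (D.lo o.swap i ≤ y ∧ y < D.hi o.swap i) := by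
  obtain ⟨x', hx', hx⟩ := D.exists_before o h₁ h₂
  obtain ⟨y', hy', hy⟩ := D.exists_after o.swap h₃ h₄
  obtain ⟨i, hi⟩ := D.cover' o x' y' hx' hy'
  exact ⟨i, hx i hi.1, hy i hi.2⟩

theorem sep' (o : Orientation) {i j : Fin n} (h : i ≠ j) :
    (D.hi o i ≤ D.lo o j ∨ D.hi o j ≤ D.lo o i) ∨
      (D.hi o.swap i ≤ D.lo o.swap j ∨ D.hi o.swap j ≤ D.lo o.swap i) := by
  obtain ⟨o', h⟩ := D.sep i j h
  rcases Orientation.eq_or_eq_swap o o' with rfl | rfl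
  exacts [.inl h, .inr h]

/-- If the side of `a` is not on the boundary, the rectangle covering the points directly across
that side, near its far end, is a neighbor. -/
theorem touches_iff (o : Orientation) (a : Fin n) : R.Touches o a ↔ D.hi o a = D.Hi o := by
  constructor
  · intro h
    by_contra hne
    have hlt : D.hi o a < D.Hi o := lt_of_le_of_ne (D.le_Hi o a) hne
    have h1 := D.lt o a
    have h2 := D.lt o.swap a
    obtain ⟨i, hi, hi'⟩ := D.germ_mp o.swap (x := D.hi o.swap a) (y := D.hi o a)
      ((D.Lo_le _ a).trans_lt h2) (D.le_Hi _ _)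
      (by simpa using (D.Lo_le o a).trans h1.le) (by simpa using hlt)
    simp only [Orientation.swap_swap] at hi'
    refine h i ((D.adj o a i).2 ⟨?_, ?_, ?_⟩)
    · have hne : a ≠ i := by rintro rfl; linarith
      rcases D.sep' o hne with (h | h) | (h | h) <;> linarith
    · linarith
    · linarith
  · intro h b hb
    have := D.lt o b
    have := D.le_Hi o b
    linarith [((D.adj o a b).1 hb).1]

theorem forall_not_adj_iff (o : Orientation) (b : Fin n) :
    (∀ a, ¬ R o a b) ↔ D.lo o b = D.Lo o := by
  constructor
  · intro h
    by_contra hne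
    have hlt : D.Lo o < D.lo o b := lt_of_le_of_ne (D.Lo_le o b) (Ne.symm hne)
    have h1 := D.lt o b
    have h2 := D.lt o.swap b
    obtain ⟨i, hi, hi'⟩ := D.germ_mp o (x := D.lo o b) (y := D.lo o.swap b) hlt
      (h1.le.trans (D.le_Hi _ _)) (D.Lo_le _ _) (h2.trans_le (D.le_Hi _ _))
    refine h i ((D.adj o i b).2 ⟨?_, ?_, ?_⟩)
    · have hne : i ≠ b := by rintro rfl; linarith
      rcases D.sep' o hne with (h | h) | (h | h) <;> linarith
    · linarith
    · linarith
  · intro h a ha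
    have := D.lt o a
    have := D.Lo_le o a
    linarith [((D.adj o a b).1 ha).1]

/-- A rectangle on the bottom that does not touch the left boundary has a left neighbor on the
bottom. -/
theorem exists_adj_touches (o : Orientation) {b : Fin n} (hb : R.Touches o.swap b)
    (h : D.Lo o < D.lo o b) : ∃ a, R o a b ∧ R.Touches o.swap a := by
  rw [D.touches_iff] at hb
  have h1 := D.lt o b
  have h2 := D.lt o.swap b
  have h3 := D.Lo_le o.swap b
  obtain ⟨a, ha, ha'⟩ := D.germ_mm o (x := D.lo o b) (y := D.Hi o.swap) h
    (h1.le.trans (D.le_Hi _ _)) (by linarith) le_rfl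
  refine ⟨a, (D.adj o a b).2 ⟨?_, ?_, ?_⟩, (D.touches_iff _ _).2 (le_antisymm (D.le_Hi _ _) ha'.2)⟩
  · have hne : a ≠ b := by rintro rfl; linarith
    rcases D.sep' o hne with (h | h) | (h | h) <;> linarith
  · linarith
  · linarith

theorem Lo_lt_lo {o : Orientation} {a b : Fin n} (h : R o a b) : D.Lo o < D.lo o b := by
  have := D.lt o a
  have := D.Lo_le o a
  linarith [((D.adj o a b).1 h).1]

/-- Walking along the bottom from `b` through left neighbors eventually reaches `a`, and every step
lowers the number. -/
theorem bottom_lt_of_le (hN : R.IsNumbered) (o : Orientation) {a b : Fin n}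
    (ha : R.Touches o.swap a) (hb : R.Touches o.swap b) (h : D.hi o a ≤ D.lo o b) : a < b := by
  induction b using WellFoundedLT.induction with
  | ind b ih =>
    have h1 := D.lt o a
    have h2 := D.Lo_le o a
    obtain ⟨c, hc, hc'⟩ := D.exists_adj_touches o hb (by linarith)
    refine lt_of_le_of_lt ?_ (hN.lt hc)
    rcases eq_or_ne a c with rfl | hne
    · exact le_rfl
    · refine (ih c (hN.lt hc) hc' ?_).le
      have h3 := D.lt o.swap a
      have h4 := D.lt o.swap c
      rw [D.touches_iff] at ha hc'
      have h5 := ((D.adj _ _ _).1 hc).1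
      rcases D.sep' o hne with (h | h) | (h | h) <;> linarith

theorem bottom_lt_iff (hN : R.IsNumbered) (o : Orientation) {a b : Fin n}
    (ha : R.Touches o.swap a) (hb : R.Touches o.swap b) : a < b ↔ D.hi o a ≤ D.lo o b := by
  refine ⟨fun hlt => ?_, D.bottom_lt_of_le hN o ha hb⟩
  have h := D.bottom_lt_of_le hN o hb ha
  have h3 := D.lt o.swap a
  have h4 := D.lt o.swap b
  rw [D.touches_iff] at ha hb
  rcases D.sep' o hlt.ne with (h' | h') | (h' | h')
  · exact h'
  · exact absurd (h h') hlt.not_gt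
  · linarith
  · linarith

theorem exists_adj_of_bottom_lt (D : Layout R) (hN : R.IsNumbered) (o : Orientation) {a b : Fin n}
    (ha : R.Touches o.swap a) (hb : R.Touches o.swap b) (h : a < b) :
    ∃ c, R o c b ∧ R.Touches o.swap c ∧ a ≤ c := by
  rw [D.bottom_lt_iff hN o ha hb] at h
  have h1 := D.lt o a
  have h2 := D.Lo_le o a
  obtain ⟨c, hc, hc'⟩ := D.exists_adj_touches o hb (by linarith)
  refine ⟨c, hc, hc', not_lt.1 fun hlt => ?_⟩
  rw [D.bottom_lt_iff hN o hc' ha] at hlt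
  linarith [((D.adj _ _ _).1 hc).1]

/-- Of two left neighbors of a rectangle, the lower one lies directly below a third (or the same)
left neighbor. -/
theorem exists_prev (o : Orientation) {a a' b : Fin n} (ha : R o a b) (ha' : R o a' b)
    (h : D.hi o.swap a ≤ D.lo o.swap a') :
    ∃ c, R o c b ∧ R o.swap c a' ∧ (a = c ∨ D.hi o.swap a ≤ D.lo o.swap c) := by
  rw [D.adj] at ha ha'
  have h1 := D.lt o a
  have h2 := D.lt o a'
  have h3 := D.lt o b
  have h4 := D.lt o.swap a
  have h5 := D.lt o.swap a'
  have h6 := D.Lo_le o a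
  have h7 := D.le_Hi o b
  have h8 := D.Lo_le o.swap b
  have h9 := D.le_Hi o.swap a'
  obtain ⟨c, hc, hc'⟩ := D.germ_mm o (x := D.lo o b) (y := D.lo o.swap a')
    (by linarith) (by linarith) (by linarith) (by linarith)
  have hcb : D.hi o c = D.lo o b := by
    have hne : c ≠ b := by rintro rfl; linarith
    rcases D.sep' o hne with (h | h) | (h | h) <;> linarith
  have hca : D.hi o.swap c = D.lo o.swap a' := by
    have hne : c ≠ a' := by rintro rfl; linarith
    rcases D.sep' o hne with (h | h) | (h | h) <;> linarith
  refine ⟨c, (D.adj _ _ _).2 ⟨hcb, by linarith, by linarith⟩,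
    (D.adj _ _ _).2 ⟨hca, ?_, ?_⟩, ?_⟩
  · rw [Orientation.swap_swap]; linarith
  · rw [Orientation.swap_swap]; linarith
  · rcases eq_or_ne a c with rfl | hne
    · exact .inl rfl
    · rcases D.sep' o hne with (h | h) | (h | h)
      · linarith
      · linarith
      · exact .inr h
      · linarith

/-- The left neighbors of `b` form a chain in which each is directly above the next (`exists_prev`),
and numbers increase along it. -/
theorem adj_lt_of_le (hN : R.IsNumbered) (o : Orientation) {a a' b : Fin n} (ha : R o a b)
    (ha' : R o a' b) (h : D.hi o.swap a ≤ D.lo o.swap a') : a < a' := by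
  induction a' using WellFoundedLT.induction with
  | ind a' ih =>
    obtain ⟨c, hc, hc', rfl | h'⟩ := D.exists_prev o ha ha' h
    · exact hN.lt hc'
    · exact (ih c (hN.lt hc') hc h').trans (hN.lt hc')

theorem adj_le_or_le (o : Orientation) {a a' b : Fin n} (ha : R o a b)
    (ha' : R o a' b) (hne : a ≠ a') :
    D.hi o.swap a ≤ D.lo o.swap a' ∨ D.hi o.swap a' ≤ D.lo o.swap a := by
  rw [D.adj] at ha ha'
  have h1 := D.lt o a
  have h2 := D.lt o a'
  rcases D.sep' o hne with (h | h) | h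
  · linarith
  · linarith
  · exact h

theorem adj_lt_iff (hN : R.IsNumbered) (o : Orientation) {a a' b : Fin n} (ha : R o a b)
    (ha' : R o a' b) : a < a' ↔ D.hi o.swap a ≤ D.lo o.swap a' := by
  refine ⟨fun hlt => ?_, D.adj_lt_of_le hN o ha ha'⟩
  rcases D.adj_le_or_le o ha ha' hlt.ne with h | h
  · exact h
  · exact absurd (D.adj_lt_of_le hN o ha' ha h) hlt.not_gt

/-- At most one right neighbor of a rectangle touches the bottom boundary. -/
theorem eq_of_adj_of_touches (D : Layout R) (o : Orientation) {a b b' : Fin n} (h : R o a b) (h' : R o a b')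
    (hb : R.Touches o.swap b) (hb' : R.Touches o.swap b') : b = b' := by
  by_contra hne
  rw [D.adj] at h h'
  rw [D.touches_iff] at hb hb'
  have h1 := D.lt o b
  have h2 := D.lt o b'
  have h3 := D.lt o.swap b
  have h4 := D.lt o.swap b'
  rcases D.sep' o hne with (h | h) | (h | h) <;> linarith

end Layout

instance : Fintype Orientation :=
  ⟨{.vertical, .horizontal}, fun o => by cases o <;> simp⟩

namespace Adjacency

/-! ### Adjacencies after an insertion, and recovery of the insertion point -/

section Insertion

variable {n : ℕ} {R : Adjacency n} {o : Orientation} {r : Fin n} {e : Option (Fin n)}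

theorem ins_castSucc {o' : Orientation} {a b : Fin n} :
    R.ins (o, r, e) o' a.castSucc b.castSucc ↔
      R o' a b ∧ ¬ (o' = o ∧ b = r ∧ ∃ a₀ ∈ e, a₀ < a) := by
  constructor
  · rintro (⟨a', b', ha, hb, h⟩ | ⟨a', -, hb, -⟩ | ⟨a', -, hb, -⟩)
    · rwa [Fin.castSucc_injective _ ha, Fin.castSucc_injective _ hb]
    · exact absurd hb (Fin.castSucc_lt_last b).ne
    · exact absurd hb (Fin.castSucc_lt_last b).ne
  · exact fun h => .inl ⟨a, b, rfl, rfl, h⟩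

theorem ins_swap_castSucc {a b : Fin n} :
    R.ins (o, r, e) o.swap a.castSucc b.castSucc ↔ R o.swap a b := by
  simp [ins_castSucc]

theorem ins_last {a : Fin n} :
    R.ins (o, r, e) o a.castSucc (Fin.last n) ↔ R o a r ∧ ∃ a₀ ∈ e, a₀ ≤ a := by
  constructor
  · rintro (⟨a', b', -, hb, -⟩ | ⟨a', ha, -, -, h⟩ | ⟨a', -, -, h, -⟩)
    · exact absurd hb (Fin.castSucc_lt_last b').ne'
    · rwa [Fin.castSucc_injective _ ha]
    · exact absurd h o.ne_swap
  · exact fun h => .inr (.inl ⟨a, rfl, rfl, rfl, h⟩)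

theorem ins_swap_last {a : Fin n} :
    R.ins (o, r, e) o.swap a.castSucc (Fin.last n) ↔ R.Touches o.swap a ∧ r ≤ a := by
  constructor
  · rintro (⟨a', b', -, hb, -⟩ | ⟨a', -, -, h, -⟩ | ⟨a', ha, -, -, h⟩)
    · exact absurd hb (Fin.castSucc_lt_last b').ne'
    · exact absurd h o.swap_ne
    · rwa [Fin.castSucc_injective _ ha]
  · exact fun h => .inr (.inr ⟨a, rfl, rfl, rfl, h⟩)

theorem not_ins_last_left {q : InsPoint n} {o' : Orientation} {b : Fin (n + 1)} :
    ¬ R.ins q o' (Fin.last n) b := by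
  rintro (⟨a', b', ha, -⟩ | ⟨a', ha, -⟩ | ⟨a', ha, -⟩) <;>
  exact (Fin.castSucc_lt_last a').ne' ha

theorem IsInsPoint.touches (h : R.IsInsPoint (o, r, e)) : R.Touches o.swap r := by
  cases e <;> exact h.1

theorem IsInsPoint.adj {a : Fin n} (h : R.IsInsPoint (o, r, e)) (ha : a ∈ e) : R o a r := by
  obtain rfl := ha
  exact h.2

theorem IsInsPoint.ins_swap_last_self (h : R.IsInsPoint (o, r, e)) :
    R.ins (o, r, e) o.swap r.castSucc (Fin.last n) :=
  ins_swap_last.2 ⟨h.touches, le_rfl⟩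

theorem IsInsPoint.orientation_eq {o' : Orientation} {r' : Fin n} {e' : Option (Fin n)}
    (h : R.IsInsPoint (o, r, e)) (hins : R.ins (o, r, e) = R.ins (o', r', e')) : o = o' := by
  rcases Orientation.eq_or_eq_swap o o' with h' | rfl
  · exact h'.symm
  · have h1 := h.ins_swap_last_self
    rw [hins, ins_last] at h1
    exact absurd h1.1 (h.touches _)

/-- The point can be read off the new rectangle: for a vertical point, `r` is the smallest rectangle
above it, and `e` is its smallest left neighbor, if there is one. The other orientation is excluded
because `r` touches the bottom and so has no lower neighbor in `R`. -/
theorem ins_injOn : Set.InjOn R.ins {q | R.IsInsPoint q} := by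
  rintro ⟨o, r, e⟩ (h : R.IsInsPoint _) ⟨o', r', e'⟩ (h' : R.IsInsPoint _) hins
  obtain rfl := h.orientation_eq hins
  have hr : r = r' := by
    have h1 := h.ins_swap_last_self
    have h2 := h'.ins_swap_last_self
    rw [hins, ins_swap_last] at h1
    rw [← hins, ins_swap_last] at h2
    exact le_antisymm h2.2 h1.2
  subst hr
  have key {e₁ e₂ : Option (Fin n)} {a : Fin n} (h₁ : R.IsInsPoint (o, r, e₁))
      (hi : R.ins (o, r, e₁) = R.ins (o, r, e₂)) (ha : a ∈ e₁) : ∃ a' ∈ e₂, a' ≤ a := by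
    have h1 : R.ins (o, r, e₁) o a.castSucc (Fin.last n) := ins_last.2 ⟨h₁.adj ha, a, ha, le_rfl⟩
    rw [hi, ins_last] at h1
    exact h1.2
  suffices e = e' by rw [this]
  cases e with
  | none =>
    cases e' with
    | none => rfl
    | some a => obtain ⟨_, h, -⟩ := key h' hins.symm rfl; cases h
  | some a =>
    obtain ⟨a', ha', hle⟩ := key h hins rfl
    obtain ⟨a'', ha'', hle'⟩ := key h' hins.symm ha'
    obtain rfl : a = a'' := Option.some_injective _ ha''
    rw [← le_antisymm hle hle']
    exact ha'.symm

/-! ### The order of insertion points -/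

theorem not_before_self (q : InsPoint n) : ¬ Before q q := by
  rcases q with ⟨_ | _, r, e⟩ <;> rintro (h | ⟨-, a, ha, a', ha', h⟩)
  · exact lt_irrefl _ h
  · rw [Option.mem_unique ha ha'] at h; exact lt_irrefl _ h
  · exact lt_irrefl _ h
  · rw [Option.mem_unique ha ha'] at h; exact lt_irrefl _ h

theorem Before.trans {q₁ q₂ q₃ : InsPoint n} (h₁ : Before q₁ q₂) (h₂ : Before q₂ q₃) :
    Before q₁ q₃ := by
  rcases q₁ with ⟨_ | _, r₁, e₁⟩ <;> rcases q₂ with ⟨_ | _, r₂, e₂⟩ <;>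
    rcases q₃ with ⟨_ | _, r₃, e₃⟩ <;> first | trivial | exact h₁.elim | exact h₂.elim | skip
  all_goals
    rcases h₁ with h₁ | ⟨rfl, a₁, ha₁, a₂, ha₂, h₁⟩ <;>
      rcases h₂ with h₂ | ⟨rfl, b₁, hb₁, b₂, hb₂, h₂⟩
    · first | exact .inl (h₁.trans h₂) | exact .inl (h₂.trans h₁)
    · exact .inl h₁
    · exact .inl h₂
    · rw [Option.mem_unique hb₁ ha₂] at h₂
      first
        | exact .inr ⟨rfl, a₁, ha₁, b₂, hb₂, h₂.trans h₁⟩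
        | exact .inr ⟨rfl, a₁, ha₁, b₂, hb₂, h₁.trans h₂⟩

/-- `none` and `some a` cannot both name points on the same side of `r`, since `none` requires that
this side has no neighbor. Hence `Before`, which compares only `some` values on one side, is total
on insertion points. -/
theorem IsInsPoint.eq_or_lt_or_lt {e' : Option (Fin n)} (h : R.IsInsPoint (o, r, e))
    (h' : R.IsInsPoint (o, r, e')) :
    e = e' ∨ (∃ a ∈ e, ∃ a' ∈ e', a < a') ∨ (∃ a ∈ e, ∃ a' ∈ e', a' < a) := by
  cases e with
  | none =>
    cases e' with
    | none => exact .inl rfl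
    | some a' => exact absurd h'.2 (h.2 a')
  | some a =>
    cases e' with
    | none => exact absurd h.2 (h'.2 a)
    | some a' =>
      rcases lt_trichotomy a a' with h | rfl | h
      · exact .inr (.inl ⟨a, rfl, a', rfl, h⟩)
      · exact .inl rfl
      · exact .inr (.inr ⟨a, rfl, a', rfl, h⟩)

theorem IsInsPoint.eq_or_before {q q' : InsPoint n} (h : R.IsInsPoint q) (h' : R.IsInsPoint q') :
    q = q' ∨ Before q q' ∨ Before q' q := by
  rcases q with ⟨_ | _, r, e⟩ <;> rcases q' with ⟨_ | _, r', e'⟩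
  · rcases lt_trichotomy r r' with hr | rfl | hr
    · exact .inr (.inl (.inl hr))
    · rcases h.eq_or_lt_or_lt h' with rfl | ⟨a, ha, a', ha', hlt⟩ | ⟨a, ha, a', ha', hlt⟩
      · exact .inl rfl
      · exact .inr (.inr (.inr ⟨rfl, a', ha', a, ha, hlt⟩))
      · exact .inr (.inl (.inr ⟨rfl, a, ha, a', ha', hlt⟩))
    · exact .inr (.inr (.inl hr))
  · exact .inr (.inl trivial)
  · exact .inr (.inr trivial)
  · rcases lt_trichotomy r r' with hr | rfl | hr
    · exact .inr (.inr (.inl hr))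
    · rcases h.eq_or_lt_or_lt h' with rfl | ⟨a, ha, a', ha', hlt⟩ | ⟨a, ha, a', ha', hlt⟩
      · exact .inl rfl
      · exact .inr (.inl (.inr ⟨rfl, a, ha, a', ha', hlt⟩))
      · exact .inr (.inr (.inr ⟨rfl, a', ha', a, ha, hlt⟩))
    · exact .inr (.inl (.inl hr))

theorem ncard_before_lt {q q' : InsPoint n} (h : R.IsInsPoint q) (hlt : Before q q') :
    {p | R.IsInsPoint p ∧ Before p q}.ncard < {p | R.IsInsPoint p ∧ Before p q'}.ncard := by
  have hsub : {p | R.IsInsPoint p ∧ Before p q} ⊆ {p | R.IsInsPoint p ∧ Before p q'} :=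
    fun p hp => ⟨hp.1, hp.2.trans hlt⟩
  refine Set.ncard_lt_ncard ((Set.ssubset_iff_of_subset hsub).2 ⟨q, ⟨h, hlt⟩, ?_⟩) (Set.toFinite _)
  exact fun hq => not_before_self q hq.2

theorem IsNthInsPoint.unique {k : ℕ} {q q' : InsPoint n} (h : R.IsNthInsPoint k q)
    (h' : R.IsNthInsPoint k q') : q = q' := by
  rcases h.1.eq_or_before h'.1 with h₁ | h₁ | h₁
  · exact h₁
  · have := ncard_before_lt h.1 h₁
    have := h.2
    have := h'.2
    omega
  · have := ncard_before_lt h'.1 h₁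
    have := h.2
    have := h'.2
    omega

theorem IsNthInsPoint.le_nu {k : ℕ} {q : InsPoint n} (h : R.IsNthInsPoint k q) : k ≤ R.nu := by
  rw [← h.2]
  refine Set.ncard_lt_ncard ?_ (Set.toFinite _)
  exact (Set.ssubset_iff_of_subset fun p hp => hp.1).2 ⟨q, h.1, fun hq => not_before_self q hq.2⟩

theorem IsInsPoint.isNthInsPoint_one {q : InsPoint n} (h : R.IsInsPoint q)
    (h' : ∀ q', R.IsInsPoint q' → ¬ Before q' q) : R.IsNthInsPoint 1 q := by
  refine ⟨h, ?_⟩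
  rw [show {q' | R.IsInsPoint q' ∧ Before q' q} = ∅ from
    Set.eq_empty_of_forall_notMem fun q' hq' => h' q' hq'.1 hq'.2, Set.ncard_empty]

theorem IsInsPoint.isNthInsPoint_nu {q : InsPoint n} (h : R.IsInsPoint q)
    (h' : ∀ q', R.IsInsPoint q' → ¬ Before q q') : R.IsNthInsPoint R.nu q := by
  refine ⟨h, ?_⟩
  rw [show {q' | R.IsInsPoint q' ∧ Before q' q} = {q' | R.IsInsPoint q'} \ {q} from ?_]
  · exact Set.ncard_sdiff_singleton_add_one h (Set.toFinite _)
  · ext q'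
    simp only [Set.mem_ofPred_eq, Set.mem_sdiff, Set.mem_singleton_iff]
    refine and_congr_right fun hq' => ⟨?_, fun hne => ?_⟩
    · rintro hb rfl
      exact not_before_self _ hb
    · exact ((hq'.eq_or_before h).resolve_left hne).resolve_right (h' q' hq')

theorem IsChild.unique {k : ℕ} {S S' : Adjacency (n + 1)} (h : R.IsChild k S)
    (h' : R.IsChild k S') : S = S' := by
  obtain ⟨q, hq, rfl⟩ := h
  obtain ⟨q', hq', rfl⟩ := h'
  rw [hq.unique hq']

theorem IsChild.index_unique {k k' : ℕ} {S : Adjacency (n + 1)} (h : R.IsChild k S)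
    (h' : R.IsChild k' S) : k = k' := by
  obtain ⟨q, hq, rfl⟩ := h
  obtain ⟨q', hq', h⟩ := h'
  obtain rfl := ins_injOn hq.1 hq'.1 h
  rw [← hq.2, ← hq'.2]

theorem IsChild.one_le {k : ℕ} {S : Adjacency (n + 1)} (h : R.IsChild k S) : 1 ≤ k := by
  obtain ⟨q, hq, -⟩ := h
  rw [← hq.2]
  omega

theorem IsChild.le_nu {k : ℕ} {S : Adjacency (n + 1)} (h : R.IsChild k S) : k ≤ R.nu := by
  obtain ⟨q, hq, -⟩ := h
  exact hq.le_nu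

end Insertion

end Adjacency

open Adjacency

/-! ### Counting insertion points, deletion after insertion, and corner insertions -/

section Corner

variable {n : ℕ} {R : Adjacency n}

/-- A point is determined by its orientation and `e`: a rectangle has at most one right neighbor on
the bottom, and only one bottom rectangle touches the left boundary. The horizontal case is the
mirror image. -/
theorem nu_le (hN : R.IsNumbered) (D : Layout R) : R.nu ≤ 2 * (n + 1) := by
  have hinj : Set.InjOn (fun q : InsPoint n => (q.1, q.2.2)) {q | R.IsInsPoint q} := by
    rintro ⟨o, r, e⟩ h ⟨o', r', e'⟩ h' heq
    obtain ⟨rfl, rfl⟩ : o = o' ∧ e = e' := by simpa using heq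
    have h₁ := h.touches
    have h₂ := h'.touches
    suffices r = r' by rw [this]
    cases e with
    | some a => exact D.eq_of_adj_of_touches o h.2 h'.2 h₁ h₂
    | none =>
      rcases lt_trichotomy r r' with hr | hr | hr
      · obtain ⟨c, hc, -⟩ := D.exists_adj_of_bottom_lt hN o h₁ h₂ hr
        exact absurd hc (h'.2 c)
      · exact hr
      · obtain ⟨c, hc, -⟩ := D.exists_adj_of_bottom_lt hN o h₂ h₁ hr
        exact absurd hc (h.2 c)
  have h := Set.ncard_le_ncard_of_injOn (t := (Finset.univ ×ˢ Finset.univ :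
    Finset (Orientation × Option (Fin n)))) _ (by simp) hinj (Set.toFinite _)
  have hcard : Fintype.card Orientation = 2 := rfl
  rw [Set.ncard_coe_finset, Finset.card_product, Finset.card_univ, Finset.card_univ] at h
  simpa [hcard, nu] using h

/-- Deletion undoes insertion. -/
theorem del_ins (hN : R.IsNumbered) (D : Layout R) {q : InsPoint n} (hq : R.IsInsPoint q) :
    (R.ins q).del = R := by
  obtain ⟨o, r, e⟩ := q
  have ht := hq.touches
  have h₁ : (R.ins (o, r, e)).Through o := by
    cases e with
    | none =>
      left
      intro a ha
      induction a using Fin.lastCases with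
      | last => exact not_ins_last_left ha
      | cast a => obtain ⟨-, _, h, -⟩ := ins_last.1 ha; cases h
    | some a₀ =>
      refine .inr ⟨a₀.castSucc, r.castSucc, ins_last.2 ⟨hq.2, a₀, rfl, le_rfl⟩,
        hq.ins_swap_last_self, ins_castSucc.2 ⟨hq.2, ?_⟩⟩
      rintro ⟨-, -, a, ha, hlt⟩
      rw [Option.mem_unique ha rfl] at hlt
      exact lt_irrefl _ hlt
  -- The rectangles above the new one touched the bottom before, so none of them is above any old
  -- rectangle, as the second alternative would require.
  have h₂ : ¬ (R.ins (o, r, e)).Through o.swap := by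
    rintro (h | ⟨a, s, ha, hs, has⟩)
    · exact h _ hq.ins_swap_last_self
    · induction a using Fin.lastCases with
      | last => exact not_ins_last_left ha
      | cast a =>
        induction s using Fin.lastCases with
        | last => exact not_ins_last_left hs
        | cast s => exact (ins_swap_last.1 ha).1 s (ins_swap_castSucc.1 has)
  funext o' a b
  rcases Orientation.eq_or_eq_swap o o' with rfl | rfl
  · refine propext ⟨?_, fun h => ?_⟩
    · rintro (h | ⟨-, h₃, h₄, h₅⟩)
      · exact (ins_castSucc.1 h).1
      · rw [ins_last] at h₃
        rw [ins_swap_last] at h₄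
        -- Any other `b` above the new rectangle has a left neighbor that is also above it, so only
        -- `r` meets the leftmost condition in `del`.
        obtain rfl : r = b := by
          refine h₄.2.eq_of_not_lt fun hlt => ?_
          obtain ⟨c, hc, hc', hrc⟩ := D.exists_adj_of_bottom_lt hN o' ht h₄.1 hlt
          refine h₅ c.castSucc (ins_swap_last.2 ⟨hc', hrc⟩) (ins_castSucc.2 ⟨hc, ?_⟩)
          rintro ⟨-, rfl, -⟩
          exact lt_irrefl _ hlt
        exact h₃.1
    · by_cases hlt : b = r ∧ ∃ a₀ ∈ e, a₀ < a
      · obtain ⟨rfl, a₀, ha₀, hlt⟩ := hlt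
        refine .inr ⟨h₁, ins_last.2 ⟨h, a₀, ha₀, hlt.le⟩, hq.ins_swap_last_self, fun c hc hcb => ?_⟩
        induction c using Fin.lastCases with
        | last => exact not_ins_last_left hc
        | cast c => exact (hN.lt (ins_castSucc.1 hcb).1).not_ge (ins_swap_last.1 hc).2
      · exact .inl (ins_castSucc.2 ⟨h, fun h' => hlt h'.2⟩)
  · refine propext ⟨?_, fun h => .inl (ins_swap_castSucc.2 h)⟩
    rintro (h | ⟨h, -⟩)
    · exact ins_swap_castSucc.1 h
    · exact absurd h h₂

/-- The corner insertion point, on the outer boundary. -/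
theorem exists_corner [NeZero n] (hN : R.IsNumbered) (D : Layout R) (o : Orientation) :
    ∃ r, R.IsInsPoint (o, r, none) ∧ ∀ a, R.Touches o.swap a → r ≤ a := by
  -- The largest number has no successors, so some rectangle touches this boundary and a smallest
  -- one exists.
  have hlast : R.Touches o.swap (Fin.rev 0) := by
    intro b hb
    have := hN.lt hb
    rw [Fin.lt_def, Fin.val_rev] at this
    have := b.isLt
    simp only [Fin.val_zero] at *
    omega
  obtain ⟨r, hr, hmin⟩ := Set.exists_min_image {a | R.Touches o.swap a} id (Set.toFinite _)
    ⟨_, hlast⟩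
  refine ⟨r, ⟨hr, ?_⟩, hmin⟩
  rw [D.forall_not_adj_iff]
  by_contra hne
  obtain ⟨a, ha, ha'⟩ := D.exists_adj_touches o hr (lt_of_le_of_ne (D.Lo_le o r) (Ne.symm hne))
  exact (hN.lt ha).not_ge (hmin a ha')

/-- `S` has a single rectangle on the bottom (for `o = .vertical`) or on the right. -/
def Adjacency.Based {n : ℕ} (S : Adjacency n) (o : Orientation) : Prop := ∃! a, S.Touches o.swap a

/-- By the choice of `r`, every rectangle that touched this boundary is now cut off from it by the
new one. -/
theorem based_ins {o : Orientation} {r : Fin n} (hmin : ∀ a, R.Touches o.swap a → r ≤ a) :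
    (R.ins (o, r, none)).Based o := by
  refine ⟨Fin.last n, fun b => not_ins_last_left, fun a ha => ?_⟩
  induction a using Fin.lastCases with
  | last => rfl
  | cast a =>
    exfalso
    refine ha (Fin.last n) (ins_swap_last.2 ⟨fun b hb => ?_, ?_⟩)
    · exact ha b.castSucc (ins_swap_castSucc.2 hb)
    · exact hmin a fun b hb => ha b.castSucc (ins_swap_castSucc.2 hb)

/-- The index of the corner insertion point. -/
noncomputable def Adjacency.cornerIndex {n : ℕ} (R : Adjacency n) : Orientation → ℕ
  | .vertical => 1
  | .horizontal => R.nu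

/-- Vertical points come first and in increasing order of `r`, horizontal ones last and in
decreasing order, so the smallest `r` gives the two extreme positions. -/
theorem isNthInsPoint_cornerIndex {o : Orientation} {r : Fin n} (h : R.IsInsPoint (o, r, none))
    (hmin : ∀ a, R.Touches o.swap a → r ≤ a) : R.IsNthInsPoint (R.cornerIndex o) (o, r, none) := by
  cases o with
  | vertical =>
    refine h.isNthInsPoint_one ?_
    rintro ⟨_ | _, r', e'⟩ hq' hb
    · rcases hb with hb | ⟨-, _, -, _, ha, -⟩
      · exact (hmin _ hq'.touches).not_gt hb
      · cases ha
    · exact hb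
  | horizontal =>
    refine h.isNthInsPoint_nu ?_
    rintro ⟨_ | _, r', e'⟩ hq' hb
    · exact hb
    · rcases hb with hb | ⟨-, _, ha, _, -⟩
      · exact (hmin _ hq'.touches).not_gt hb
      · cases ha

theorem based_of_isChild_cornerIndex [NeZero n] (hN : R.IsNumbered) (D : Layout R)
    {o : Orientation} {S : Adjacency (n + 1)} (h : R.IsChild (R.cornerIndex o) S) : S.Based o := by
  obtain ⟨r, hr, hmin⟩ := exists_corner hN D o
  rw [h.unique ⟨_, isNthInsPoint_cornerIndex hr hmin, rfl⟩]
  exact based_ins hmin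

end Corner

/-! ### Every rectangulation arises by insertion -/

section Recover

variable {n : ℕ} {S : Adjacency (n + 1)}

/-- Off the boundary, four quadrants meet at the top-left vertex of the last rectangle `l`: let `a`
be the rectangle directly left of it, `s` the one directly above it, and `u` the one in the opposite
quadrant. No four rectangles share a point, so `u` equals `a` or `s`, and this decides which wall
passes through. -/
theorem through_or (D : Layout S) (hlast : ∀ o b, ¬ S o (Fin.last n) b) (o : Orientation) :
    S.Through o ∨ S.Through o.swap := by
  set l := Fin.last n
  have hb o : D.hi o l = D.Hi o := (D.touches_iff o l).1 (hlast o)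
  by_cases h₁ : D.lo o l = D.Lo o
  · exact .inl (.inl ((D.forall_not_adj_iff o l).2 h₁))
  by_cases h₂ : D.lo o.swap l = D.Lo o.swap
  · exact .inr (.inl ((D.forall_not_adj_iff o.swap l).2 h₂))
  replace h₁ := lt_of_le_of_ne (D.Lo_le o l) (Ne.symm h₁)
  replace h₂ := lt_of_le_of_ne (D.Lo_le o.swap l) (Ne.symm h₂)
  have h3 := D.lt o l
  have h4 := D.lt o.swap l
  have h5 := D.le_Hi o l
  have h6 := D.le_Hi o.swap l
  obtain ⟨a, ha, ha'⟩ := D.germ_mp o (x := D.lo o l) (y := D.lo o.swap l) h₁ (by linarith)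
    h₂.le (by linarith)
  obtain ⟨s, hs', hs⟩ := D.germ_mp o.swap (x := D.lo o.swap l) (y := D.lo o l) h₂ (by linarith)
    (by simpa using h₁.le) (by simpa using (by linarith : D.lo o l < D.Hi o))
  rw [Orientation.swap_swap] at hs
  obtain ⟨u, hu, hu'⟩ := D.germ_mm o (x := D.lo o l) (y := D.lo o.swap l) h₁ (by linarith)
    h₂ (by linarith)
  have hal : a ≠ l := by rintro rfl; linarith
  have hsl : s ≠ l := by rintro rfl; linarith
  have hul : u ≠ l := by rintro rfl; linarith
  have hal' : D.hi o a = D.lo o l := by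
    rcases D.sep' o hal with (h | h) | (h | h) <;> linarith
  have hsl' : D.hi o.swap s = D.lo o.swap l := by
    rcases D.sep' o hsl with (h | h) | (h | h) <;> linarith
  have hal'' : S o a l := (D.adj _ _ _).2 ⟨hal', by linarith, by linarith⟩
  have hsl'' : S o.swap s l := by
    refine (D.adj _ _ _).2 ⟨hsl', ?_, ?_⟩ <;> rw [Orientation.swap_swap] <;> linarith
  have has : a ≠ s := by rintro rfl; linarith
  by_cases hua : u = a
  · subst hua
    refine .inl (.inr ⟨u, s, hal'', hsl'', (D.adj _ _ _).2 ⟨?_, ?_, ?_⟩⟩)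
    · rcases D.sep' o has with (h | h) | (h | h) <;> linarith
    · linarith
    · linarith [D.lt o.swap s]
  by_cases hus : u = s
  · subst hus
    refine .inr (.inr ⟨u, a, hsl'', by simpa using hal'', (D.adj _ _ _).2 ⟨?_, ?_, ?_⟩⟩)
    · rcases D.sep' o has with (h | h) | (h | h) <;> linarith
    · rw [Orientation.swap_swap]; linarith
    · rw [Orientation.swap_swap]; linarith [D.lt o a]
  exfalso
  have := D.generic (fun o => D.lo o l) {a, s, u, l} (by
    intro i hi
    rw [Orientation.forall_iff o]
    simp only [Finset.mem_insert, Finset.mem_singleton] at hi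
    rcases hi with rfl | rfl | rfl | rfl
    · exact ⟨⟨ha.1.le, ha.2⟩, ⟨ha'.1, ha'.2.le⟩⟩
    · exact ⟨⟨hs.1, hs.2.le⟩, ⟨hs'.1.le, hs'.2⟩⟩
    · exact ⟨⟨hu.1.le, hu.2⟩, ⟨hu'.1.le, hu'.2⟩⟩
    · exact ⟨⟨le_rfl, h3.le⟩, ⟨le_rfl, h4.le⟩⟩)
  rw [Finset.card_insert_of_notMem (by simp [has, hal, Ne.symm hua]),
    Finset.card_insert_of_notMem (by simp [hsl, Ne.symm hus]),
    Finset.card_insert_of_notMem (by simp [hul]), Finset.card_singleton] at this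
  omega

/-- Not both sides of the last rectangle touch the boundary. -/
theorem exists_adj_last [NeZero n] (D : Layout S) (hlast : ∀ o b, ¬ S o (Fin.last n) b)
    (o : Orientation) : ∃ o' a, S o' a (Fin.last n) ∧ (o' = o ∨ ∀ b, ¬ S o b (Fin.last n)) := by
  by_cases h : ∃ a, S o a (Fin.last n)
  · exact ⟨o, h.choose, h.choose_spec, .inl rfl⟩
  push Not at h
  by_cases h' : ∃ a, S o.swap a (Fin.last n)
  · exact ⟨o.swap, h'.choose, h'.choose_spec, .inr h⟩
  push Not at h'
  exfalso
  have h1 := (D.forall_not_adj_iff _ _).1 h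
  have h2 := (D.forall_not_adj_iff _ _).1 h'
  have h3 := (D.touches_iff o _).1 (hlast o)
  have h4 := (D.touches_iff o.swap _).1 (hlast o.swap)
  have hne : (Fin.castSucc (0 : Fin n)) ≠ Fin.last n := (Fin.castSucc_lt_last _).ne
  have h5 := D.lt o (Fin.castSucc (0 : Fin n))
  have h6 := D.lt o.swap (Fin.castSucc (0 : Fin n))
  have h7 := D.Lo_le o (Fin.castSucc (0 : Fin n))
  have h8 := D.Lo_le o.swap (Fin.castSucc (0 : Fin n))
  have h9 := D.le_Hi o (Fin.castSucc (0 : Fin n))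
  have h10 := D.le_Hi o.swap (Fin.castSucc (0 : Fin n))
  rcases D.sep' o hne with (h | h) | (h | h) <;> linarith

/-- If walls of both orientations passed through the vertex, a left neighbor `a` and an upper
neighbor `a'` of the last rectangle would both fill the quadrant opposite to it, and hence overlap.
-/
theorem not_through_swap [NeZero n] (D : Layout S) (hlast : ∀ o b, ¬ S o (Fin.last n) b)
    {o : Orientation} (h : S.Through o) : ¬ S.Through o.swap := by
  obtain ⟨o', c, hc, hc'⟩ := exists_adj_last D hlast o
  rcases h with h | ⟨a, s, ha, hs, has⟩
  · rintro (h' | ⟨a, s, ha, hs, has⟩)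
    · rcases Orientation.eq_or_eq_swap o o' with rfl | rfl
      exacts [h _ hc, h' _ hc]
    · rw [Orientation.swap_swap] at hs
      exact h _ hs
  · rintro (h' | ⟨a', s', ha', hs', has'⟩)
    · exact h' _ hs
    · rw [Orientation.swap_swap] at hs'
      rw [D.adj] at ha hs has ha' hs' has'
      rw [Orientation.swap_swap] at hs ha' has'
      have := D.lt o a
      have := D.lt o.swap a
      have := D.lt o a'
      have := D.lt o.swap a'
      have hne : a ≠ a' := by rintro rfl; linarith
      rcases D.sep' o hne with (h | h) | (h | h) <;> linarith

/-- The insertion point from which the last rectangle was inserted. -/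
theorem exists_corner_data [NeZero n] (D : Layout S) (hlast : ∀ o b, ¬ S o (Fin.last n) b)
    {o : Orientation} (h : S.Through o) :
    ∃ (r : Fin n) (e : Option (Fin n)), S o.swap r.castSucc (Fin.last n) ∧
      D.lo o r.castSucc = D.lo o (Fin.last n) ∧ (e = none → ∀ a, ¬ S o a (Fin.last n)) ∧
      ∀ a₀ ∈ e, S o a₀.castSucc (Fin.last n) ∧ S o a₀.castSucc r.castSucc := by
  rcases h with h | ⟨a, s, ha, hs, has⟩
  · obtain ⟨o', c, hc, hc'⟩ := exists_adj_last D hlast o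
    rcases Orientation.eq_or_eq_swap o o' with rfl | rfl
    · exact absurd hc (h c)
    have h1 := (D.forall_not_adj_iff _ _).1 h
    have h2 := D.Lo_lt_lo hc
    have h3 := D.lt o (Fin.last n)
    have h4 := D.lt o.swap (Fin.last n)
    have h5 := D.le_Hi o (Fin.last n)
    have h6 := D.le_Hi o.swap (Fin.last n)
    obtain ⟨s, hs', hs⟩ := D.germ_mp o.swap (x := D.lo o.swap (Fin.last n))
      (y := D.lo o (Fin.last n)) h2 (by linarith) (by simpa using h1.ge)
      (by simpa using (by linarith : D.lo o (Fin.last n) < D.Hi o))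
    rw [Orientation.swap_swap] at hs
    have hsl : s ≠ Fin.last n := by rintro rfl; linarith
    have hsl' : D.hi o.swap s = D.lo o.swap (Fin.last n) := by
      rcases D.sep' o hsl with (h | h) | (h | h) <;> linarith
    have hsl'' : S o.swap s (Fin.last n) := by
      refine (D.adj _ _ _).2 ⟨hsl', ?_, ?_⟩ <;> rw [Orientation.swap_swap] <;> linarith
    have := D.Lo_le o s
    obtain ⟨r, rfl⟩ := Fin.exists_castSucc_eq.2 hsl
    exact ⟨r, none, hsl'', by linarith, fun _ => h, by simp⟩
  · obtain ⟨a, rfl⟩ := Fin.exists_castSucc_eq.2 (fun h => hlast _ _ (h ▸ ha) : a ≠ Fin.last n)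
    obtain ⟨s, rfl⟩ := Fin.exists_castSucc_eq.2 (fun h => hlast _ _ (h ▸ hs) : s ≠ Fin.last n)
    refine ⟨s, some a, hs, ?_, by simp, ?_⟩
    · rw [D.adj] at ha has
      linarith
    · rintro a₀ ⟨⟩
      exact ⟨ha, has⟩

/-- In terms of `o = .vertical`: `r` is the first rectangle above the last one, and `e` is the
rectangle whose right side contains the top-left vertex. This rectangle is the lowest left neighbor
of `r` and the topmost left neighbor of the last rectangle, so comparing numbers with it separates
the two sets of neighbors, exactly as `ins` does. -/
theorem eq_ins_of_through [NeZero n] (hN : S.IsNumbered) (D : Layout S) {o : Orientation}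
    (h : S.Through o) : ∃ q, S.del.IsInsPoint q ∧ S = S.del.ins q := by
  have hlast := hN.1
  have hN' := hN.2
  have hns := not_through_swap D hlast h
  obtain ⟨r, e, hr, hrlo, hnone, hsome⟩ := exists_corner_data D hlast h
  have hswap {a b : Fin n} : S.del o.swap a b ↔ S o.swap a.castSucc b.castSucc :=
    ⟨fun hab => hab.resolve_right fun hab => hns hab.1, .inl⟩
  have hright {x} (hx : S o.swap x (Fin.last n)) :
      x = r.castSucc ∨ D.hi o r.castSucc ≤ D.lo o x := by
    by_contra! hne
    have h1 := D.adj_le_or_le o.swap hx hr hne.1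
    rw [Orientation.swap_swap] at h1
    rw [D.adj, Orientation.swap_swap] at hx
    rcases h1 with h1 | h1 <;> linarith
  have hrmin {x : Fin n} (hx : S o.swap x.castSucc (Fin.last n)) : r ≤ x := by
    rcases hright hx with h1 | h1
    · exact (Fin.castSucc_injective _ h1).ge
    · exact (Fin.castSucc_lt_castSucc_iff.1
        (D.adj_lt_of_le hN o.swap hr hx (by rwa [Orientation.swap_swap]))).le
  -- `x` starts no further left than the last rectangle, which extends to the outer boundary, so
  -- there is no room for another lower neighbor.
  have honly {x b} (hx : S o.swap x (Fin.last n)) (hb : S o.swap x b) : b = Fin.last n := by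
    have h1 : D.lo o (Fin.last n) ≤ D.lo o x := by
      have := D.lt o r.castSucc
      rcases hright hx with rfl | h1 <;> linarith
    by_contra hne
    have h2 := (D.touches_iff o _).1 (hlast o)
    have h3 := D.le_Hi o x
    have h4 := D.lt o.swap b
    have h5 := D.lt o.swap (Fin.last n)
    rw [D.adj, Orientation.swap_swap] at hx hb
    rcases D.sep' o hne with (h | h) | (h | h) <;> linarith
  have hemin {a₀ a : Fin n} (ha₀ : a₀ ∈ e) (ha : S o a.castSucc (Fin.last n)) : a₀ ≤ a := by
    refine not_lt.1 fun hlt => ?_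
    obtain ⟨h1, h2⟩ := hsome a₀ ha₀
    have h3 := (D.adj_lt_iff hN o ha h1).1 (Fin.castSucc_lt_castSucc_iff.2 hlt)
    rw [D.adj] at h1 h2 ha hr
    linarith
  have hemax {a₀ a : Fin n} (ha₀ : a₀ ∈ e) (ha : S o a.castSucc r.castSucc) : a ≤ a₀ := by
    refine not_lt.1 fun hlt => ?_
    obtain ⟨h1, h2⟩ := hsome a₀ ha₀
    have h3 := (D.adj_lt_iff hN o h2 ha).1 (Fin.castSucc_lt_castSucc_iff.2 hlt)
    rw [D.adj] at h1 h2 ha hr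
    linarith
  have hdel {a b : Fin n} : S.del o a b ↔
      S o a.castSucc b.castSucc ∨ (S o a.castSucc (Fin.last n) ∧ b = r) := by
    refine or_congr_right ⟨fun ⟨_, h1, h2, h3⟩ => ⟨h1, ?_⟩, ?_⟩
    · by_contra hne
      have h4 := (hright h2).resolve_left fun h4 => hne (Fin.castSucc_injective _ h4)
      obtain ⟨c, hc, hc', -⟩ := D.exists_prev o.swap hr h2 (by rwa [Orientation.swap_swap])
      rw [Orientation.swap_swap] at hc'
      exact h3 c hc hc'
    · rintro ⟨h1, rfl⟩
      refine ⟨h, h1, hr, fun c hc hcb => ?_⟩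
      rw [D.adj] at hc hcb
      rw [Orientation.swap_swap] at hc
      linarith
  have htouch {x : Fin n} (hx : S o.swap x.castSucc (Fin.last n)) : S.del.Touches o.swap x :=
    fun b hb => (Fin.castSucc_lt_last b).ne (honly hx (hswap.1 hb))
  refine ⟨(o, r, e), ?_, ?_⟩
  · cases e with
    | none =>
      refine ⟨htouch hr, fun a ha => ?_⟩
      rcases hdel.1 ha with ha | ⟨ha, -⟩
      · have h1 := (D.forall_not_adj_iff _ _).1 (hnone rfl)
        exact (D.forall_not_adj_iff _ _).2 (hrlo.trans h1) _ ha
      · exact hnone rfl _ ha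
    | some a₀ => exact ⟨htouch hr, hdel.2 (.inl (hsome a₀ rfl).2)⟩
  · funext o' a b
    refine propext ?_
    induction a using Fin.lastCases with
    | last => exact ⟨fun h => absurd h (hlast _ _), fun h => absurd h not_ins_last_left⟩
    | cast a =>
      rcases Orientation.eq_or_eq_swap o o' with rfl | rfl
      · induction b using Fin.lastCases with
        | last =>
          rw [ins_last, hdel]
          constructor
          · intro ha
            refine ⟨.inr ⟨ha, rfl⟩, ?_⟩
            cases e with
            | none => exact absurd ha (hnone rfl _)
            | some a₀ => exact ⟨a₀, rfl, hemin rfl ha⟩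
          · rintro ⟨h1 | h1, a₀, ha₀, hle⟩
            · rw [le_antisymm (hemax ha₀ h1) hle]
              exact (hsome a₀ ha₀).1
            · exact h1.1
        | cast b =>
          rw [ins_castSucc, hdel]
          constructor
          · refine fun hab => ⟨.inl hab, ?_⟩
            rintro ⟨-, rfl, a₀, ha₀, hlt⟩
            exact hlt.not_ge (hemax ha₀ hab)
          · rintro ⟨h1 | ⟨h1, rfl⟩, h2⟩
            · exact h1
            · cases e with
              | none => exact absurd h1 (hnone rfl _)
              | some a₀ =>
                rw [(hemin rfl h1).antisymm' (not_lt.1 fun hlt => h2 ⟨rfl, rfl, a₀, rfl, hlt⟩)]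
                exact (hsome a₀ rfl).2
      · induction b using Fin.lastCases with
        | last =>
          rw [ins_swap_last]
          refine ⟨fun ha => ⟨htouch ha, hrmin ha⟩, fun ⟨h1, h2⟩ => ?_⟩
          -- Otherwise `a` already touches the bottom in `S`, and some left neighbor `c` of the last
          -- rectangle satisfies `a ≤ c`. After deletion `c` is left of `r`, so `c < r ≤ a`, a
          -- contradiction.
          by_contra hal
          have h3 : S.Touches o.swap a.castSucc := fun b hb => by
            induction b using Fin.lastCases with
            | last => exact hal hb
            | cast b => exact h1 b (hswap.2 hb)
          obtain ⟨c, hc, hc', hac⟩ := D.exists_adj_of_bottom_lt hN o h3 (hlast _)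
            (Fin.castSucc_lt_last a)
          obtain ⟨c, rfl⟩ := Fin.exists_castSucc_eq.2
            (fun h => hlast _ _ (h ▸ hc) : c ≠ Fin.last n)
          have := hN'.lt (hdel.2 (.inr ⟨hc, rfl⟩))
          have := Fin.castSucc_le_castSucc_iff.1 hac
          omega
        | cast b => rw [ins_swap_castSucc, hswap]

/-- Every rectangulation with at least two rectangles arises by insertion from its parent. -/
theorem exists_eq_ins [NeZero n] (hN : S.IsNumbered) (D : Layout S) :
    ∃ q, S.del.IsInsPoint q ∧ S = S.del.ins q := by
  rcases through_or D hN.1 .vertical with h | h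
  · exact eq_ins_of_through hN D h
  · exact eq_ins_of_through hN D h

/-- A left neighbor would leave room for a second rectangle on the bottom, namely the lowest left
neighbor. -/
theorem Adjacency.Based.not_adj_last (hN : S.IsNumbered) (D : Layout S) {o : Orientation}
    (h : S.Based o) (a : Fin (n + 1)) : ¬ S o a (Fin.last n) := fun ha => by
  obtain ⟨c, hc, hc'⟩ := D.exists_adj_touches o (hN.1 o.swap) (D.Lo_lt_lo ha)
  have := h.unique hc' (hN.1 o.swap)
  subst this
  exact hN.1 _ _ hc

/-- Converse of `based_of_isChild_cornerIndex`. Jumps of earlier rectangles are thus governed by the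
parent alone, because a based rectangulation is determined by its parent and orientation. -/
theorem isChild_cornerIndex_of_based [NeZero n] (hN : S.IsNumbered) (D : Layout S)
    (D' : Layout S.del) {o : Orientation} (h : S.Based o) :
    S.del.IsChild (S.del.cornerIndex o) S := by
  have hno := h.not_adj_last hN D
  obtain ⟨⟨o', r, e⟩, hq, heq⟩ := exists_eq_ins hN D
  have hr := hq.ins_swap_last_self
  rw [← heq] at hr
  rcases Orientation.eq_or_eq_swap o o' with rfl | rfl
  · obtain rfl : e = none := by
      cases e with
      | none => rfl
      | some a =>
        refine absurd ?_ (hno a.castSucc)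
        rw [heq, ins_last]
        exact ⟨hq.2, a, rfl, le_rfl⟩
    refine ⟨_, isNthInsPoint_cornerIndex hq fun a ha => not_lt.1 fun hlt => ?_, heq⟩
    obtain ⟨c, hc, -⟩ := D'.exists_adj_of_bottom_lt hN.2 o' ha hq.touches hlt
    exact hq.2 c hc
  · rw [Orientation.swap_swap] at hr
    exact absurd hr (hno _)

theorem Adjacency.Based.not_swap [NeZero n] (hN : S.IsNumbered) (D : Layout S) {o : Orientation}
    (h : S.Based o) : ¬ S.Based o.swap := by
  intro h'
  obtain ⟨o', c, hc, -⟩ := exists_adj_last D hN.1 o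
  rcases Orientation.eq_or_eq_swap o o' with rfl | rfl
  exacts [h.not_adj_last hN D _ hc, h'.not_adj_last hN D _ hc]

end Recover

/-! ### Insertion preserves containment of patterns -/

section Walls

variable {n : ℕ} {R : Adjacency n}

theorem edge_iff_of_eqvGen {o : Orientation} {f g : Fin n × Fin n}
    (h : Relation.EqvGen (R.Next o) f g) : R o f.1 f.2 ↔ R o g.1 g.2 := by
  induction h with
  | rel _ _ h => exact ⟨fun _ => h.2.1, fun _ => h.1⟩
  | refl => exact Iff.rfl
  | symm _ _ _ ih => exact ih.symm
  | trans _ _ _ _ _ ih ih' => exact ih.trans ih'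

theorem Adjacency.IsWall.edge {o : Orientation} {W : Set (Fin n × Fin n)} (h : R.IsWall o W)
    {f : Fin n × Fin n} (hf : f ∈ W) : R o f.1 f.2 := by
  obtain ⟨e, he, rfl⟩ := h
  exact (edge_iff_of_eqvGen hf).1 he

theorem Adjacency.IsWall.mem_of_eqvGen {o : Orientation} {W : Set (Fin n × Fin n)}
    (h : R.IsWall o W) {f g : Fin n × Fin n} (hf : f ∈ W) (hfg : Relation.EqvGen (R.Next o) f g) :
    g ∈ W := by
  obtain ⟨e, he, rfl⟩ := h
  exact Relation.EqvGen.trans _ _ _ hf hfg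

/-- All edges on the left side of a rectangle belong to the same wall. -/
theorem Layout.eqvGen_next (D : Layout R) (hN : R.IsNumbered) {o : Orientation} {a a' b : Fin n}
    (ha : R o a b) (ha' : R o a' b) : Relation.EqvGen (R.Next o) (a, b) (a', b) := by
  have key {a a' : Fin n} (ha : R o a b) (ha' : R o a' b) (h : a < a') :
      Relation.EqvGen (R.Next o) (a, b) (a', b) := by
    induction a' using WellFoundedLT.induction with
    | ind a' ih =>
      obtain ⟨c, hc, hc', h'⟩ := D.exists_prev o ha ha' ((D.adj_lt_iff hN o ha ha').1 h)
      refine Relation.EqvGen.trans _ (c, b) _ ?_ (.rel _ _ ⟨hc, ha', .inl ⟨rfl, hc'⟩⟩)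
      rcases h' with rfl | h'
      · exact .refl _
      · exact ih c (hN.lt hc') hc (D.adj_lt_of_le hN o ha hc h')
  rcases lt_trichotomy a a' with h | rfl | h
  · exact key ha ha' h
  · exact .refl _
  · exact .symm _ _ (key ha' ha h)

/-- Two edges on the left side of `b` of which the first one lies above the second one leave no
room for a third edge between them. -/
theorem Layout.le_of_lt_of_adj (D : Layout R) (hN : R.IsNumbered) {o : Orientation}
    {a a' c b : Fin n} (ha : R o a b) (ha' : R o a' b) (hc : R o c b) (h : R o.swap a a')
    (hlt : c < a') : c ≤ a := by
  refine not_lt.1 fun hlt' => ?_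
  rw [D.adj_lt_iff hN o hc ha'] at hlt
  rw [D.adj_lt_iff hN o ha hc] at hlt'
  have := D.lt o.swap c
  linarith [((D.adj _ _ _).1 h).1]

/-- The topmost edge on the left side of `b`, below a T-joint with stem pointing down. -/
theorem Layout.le_of_adj_top (D : Layout R) (hN : R.IsNumbered) {o : Orientation}
    {s a b c : Fin n} (hs : R o.swap s a) (hs' : R o.swap s b) (ha : R o a b) (hc : R o c b) :
    a ≤ c := by
  refine not_lt.1 fun hlt => ?_
  rw [D.adj_lt_iff hN o hc ha] at hlt
  rw [D.adj] at hs hs' hc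
  linarith

/-- The topmost edge on the left side of `b`, below a T-joint with stem pointing right. -/
theorem Layout.le_of_adj_stem (D : Layout R) (hN : R.IsNumbered) {o : Orientation}
    {s a b c : Fin n} (hs : R o a s) (hs' : R o.swap s b) (ha : R o a b) (hc : R o c b) :
    a ≤ c := by
  refine not_lt.1 fun hlt => ?_
  rw [D.adj_lt_iff hN o hc ha] at hlt
  rw [D.adj] at hs hs' hc
  linarith

end Walls

/-! ### Lifting edges and walls through an insertion -/

section Lift

variable {n : ℕ}

/-- An edge of a rectangulation as an edge after insertion at `(o, r, e)`; the edge that is split by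
the insertion corresponds to its upper part. -/
noncomputable def liftTop (o : Orientation) (r : Fin n) (e : Option (Fin n)) (o' : Orientation)
    (f : Fin n × Fin n) : Fin (n + 1) × Fin (n + 1) :=
  open Classical in
  if o' = o ∧ f.2 = r ∧ ∃ a₀ ∈ e, a₀ < f.1 then (f.1.castSucc, Fin.last n)
  else (f.1.castSucc, f.2.castSucc)

/-- Like `liftTop`, but the edge that is split corresponds to its lower part. -/
noncomputable def liftBot (o : Orientation) (r : Fin n) (e : Option (Fin n)) (o' : Orientation)
    (f : Fin n × Fin n) : Fin (n + 1) × Fin (n + 1) :=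
  open Classical in
  if o' = o ∧ f.2 = r ∧ ∃ a₀ ∈ e, a₀ ≤ f.1 then (f.1.castSucc, Fin.last n)
  else (f.1.castSucc, f.2.castSucc)

theorem liftTop_swap (o : Orientation) (r : Fin n) (e : Option (Fin n)) (f : Fin n × Fin n) :
    liftTop o r e o.swap f = (f.1.castSucc, f.2.castSucc) := by simp [liftTop]

theorem liftBot_swap (o : Orientation) (r : Fin n) (e : Option (Fin n)) (f : Fin n × Fin n) :
    liftBot o r e o.swap f = (f.1.castSucc, f.2.castSucc) := by simp [liftBot]

variable {R : Adjacency n} {o : Orientation} {r : Fin n} {e : Option (Fin n)}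

theorem ins_liftTop {o' : Orientation} {f : Fin n × Fin n} (h : R o' f.1 f.2) :
    R.ins (o, r, e) o' (liftTop o r e o' f).1 (liftTop o r e o' f).2 := by
  unfold liftTop
  split_ifs with hf
  · obtain ⟨rfl, rfl, a, ha, hlt⟩ := hf
    exact ins_last.2 ⟨h, a, ha, hlt.le⟩
  · exact ins_castSucc.2 ⟨h, hf⟩

theorem ins_liftBot {o' : Orientation} {f : Fin n × Fin n} (h : R o' f.1 f.2) :
    R.ins (o, r, e) o' (liftBot o r e o' f).1 (liftBot o r e o' f).2 := by
  unfold liftBot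
  split_ifs with hf
  · obtain ⟨rfl, rfl, hf⟩ := hf
    exact ins_last.2 ⟨h, hf⟩
  · refine ins_castSucc.2 ⟨h, fun h' => hf ⟨h'.1, h'.2.1, ?_⟩⟩
    obtain ⟨a, ha, hlt⟩ := h'.2.2
    exact ⟨a, ha, hlt.le⟩

/-- The lifts differ only for the split edge `(a₀, r)` with `e = some a₀`, whose two halves are
consecutive because `r` lies directly above the new rectangle. -/
theorem liftBot_eq_or_next (hq : R.IsInsPoint (o, r, e)) {o' : Orientation} {f : Fin n × Fin n}
    (h : R o' f.1 f.2) : liftBot o r e o' f = liftTop o r e o' f ∨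
      (R.ins (o, r, e)).Next o' (liftTop o r e o' f) (liftBot o r e o' f) := by
  by_cases h₁ : o' = o ∧ f.2 = r ∧ ∃ a₀ ∈ e, a₀ < f.1
  · have h₂ : o' = o ∧ f.2 = r ∧ ∃ a₀ ∈ e, a₀ ≤ f.1 := by
      obtain ⟨h, h', a, ha, hlt⟩ := h₁
      exact ⟨h, h', a, ha, hlt.le⟩
    exact .inl (by rw [liftBot, liftTop, if_pos h₁, if_pos h₂])
  · by_cases h₂ : o' = o ∧ f.2 = r ∧ ∃ a₀ ∈ e, a₀ ≤ f.1
    · refine .inr ⟨ins_liftTop h, ins_liftBot h, .inr ?_⟩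
      rw [liftBot, liftTop, if_neg h₁, if_pos h₂]
      obtain ⟨rfl, hr, -⟩ := h₂
      refine ⟨rfl, ?_⟩
      rw [hr]
      exact hq.ins_swap_last_self
    · exact .inl (by rw [liftBot, liftTop, if_neg h₁, if_neg h₂])

/-- The vertex between consecutive edges is at the lower end of the first and the upper end of the
second, hence the two kinds of lift. With a common right rectangle, no left neighbor fits between
the two edges, so `a₀ ≤ a` and `a₀ < a'` are equivalent and both edges move to the new rectangle or
neither does. -/
theorem next_lift (hN : R.IsNumbered) (D : Layout R) (hq : R.IsInsPoint (o, r, e))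
    {o' : Orientation} {f g : Fin n × Fin n} (h : R.Next o' f g) :
    (R.ins (o, r, e)).Next o' (liftBot o r e o' f) (liftTop o r e o' g) := by
  refine ⟨ins_liftBot h.1, ins_liftTop h.2.1, ?_⟩
  obtain ⟨a, b⟩ := f
  obtain ⟨a', b'⟩ := g
  obtain ⟨hf, hg, h⟩ := h
  dsimp only at hf hg h
  rcases Orientation.eq_or_eq_swap o o' with rfl | rfl
  · rcases h with ⟨rfl, h⟩ | ⟨rfl, h⟩
    · left
      have hiff : (b = r ∧ ∃ a₀ ∈ e, a₀ ≤ a) ↔ (b = r ∧ ∃ a₀ ∈ e, a₀ < a') := by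
        constructor
        · rintro ⟨hb, a₀, ha₀, hle⟩
          exact ⟨hb, a₀, ha₀, hle.trans_lt (hN.lt h)⟩
        · rintro ⟨rfl, a₀, ha₀, hlt⟩
          exact ⟨rfl, a₀, ha₀, D.le_of_lt_of_adj hN hf hg (hq.adj ha₀) h hlt⟩
      by_cases hlt : b = r ∧ ∃ a₀ ∈ e, a₀ < a'
      · have hle := hiff.2 hlt
        simp only [liftBot, liftTop, hle, hlt, true_and]
        simp only [if_true, true_and]
        exact ins_swap_castSucc.2 h
      · have hle := mt hiff.1 hlt
        simp only [liftBot, liftTop, hle, hlt, true_and, if_false]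
        exact ins_swap_castSucc.2 h
    · right
      have hb : b ≠ r := by
        rintro rfl
        exact hq.touches _ h
      have hlt : ¬ (b' = r ∧ ∃ a₀ ∈ e, a₀ < a) := by
        rintro ⟨rfl, a₀, ha₀, hlt⟩
        exact hlt.not_ge (D.le_of_adj_stem hN hf h hg (hq.adj ha₀))
      simp only [liftBot, liftTop, hb, hlt, true_and, if_false, and_false, false_and]
      exact ins_swap_castSucc.2 h
  · rw [Orientation.swap_swap] at h ⊢
    rw [liftBot_swap, liftTop_swap]
    rcases h with ⟨rfl, h⟩ | ⟨rfl, h⟩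
    · refine .inl ⟨rfl, ins_castSucc.2 ⟨h, ?_⟩⟩
      rintro ⟨-, rfl, -⟩
      exact hq.touches _ hg
    · refine .inr ⟨rfl, ins_castSucc.2 ⟨h, ?_⟩⟩
      rintro ⟨-, rfl, a₀, ha₀, hlt⟩
      exact hlt.not_ge (D.le_of_adj_top hN hf hg h (hq.adj ha₀))

theorem reflTransGen_lift (hq : R.IsInsPoint (o, r, e)) {o' : Orientation} {f : Fin n × Fin n}
    (h : R o' f.1 f.2) : Relation.ReflTransGen ((R.ins (o, r, e)).Next o') (liftTop o r e o' f)
      (liftBot o r e o' f) := by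
  rcases liftBot_eq_or_next hq h with h | h
  · rw [h]
  · exact .single h

theorem transGen_lift (hN : R.IsNumbered) (D : Layout R) (hq : R.IsInsPoint (o, r, e))
    {o' : Orientation} {f g : Fin n × Fin n} (h : Relation.TransGen (R.Next o') f g) :
    Relation.TransGen ((R.ins (o, r, e)).Next o') (liftBot o r e o' f) (liftTop o r e o' g) := by
  induction h with
  | single h => exact .single (next_lift hN D hq h)
  | tail _ h ih => exact (ih.trans_left (reflTransGen_lift hq h.1)).tail (next_lift hN D hq h)

theorem eqvGen_of_reflTransGen {α : Type*} {p : α → α → Prop} {x y : α}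
    (h : Relation.ReflTransGen p x y) : Relation.EqvGen p x y := by
  induction h with
  | refl => exact .refl _
  | tail _ h ih => exact .trans _ _ _ ih (.rel _ _ h)

theorem eqvGen_lift (hN : R.IsNumbered) (D : Layout R) (hq : R.IsInsPoint (o, r, e))
    {o' : Orientation} {f g : Fin n × Fin n} (h : Relation.EqvGen (R.Next o') f g) :
    Relation.EqvGen ((R.ins (o, r, e)).Next o') (liftTop o r e o' f) (liftTop o r e o' g) := by
  induction h with
  | rel _ _ h =>
    exact .trans _ _ _ (eqvGen_of_reflTransGen (reflTransGen_lift hq h.1))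
      (.rel _ _ (next_lift hN D hq h))
  | refl => exact .refl _
  | symm _ _ _ ih => exact .symm _ _ ih
  | trans _ _ _ _ _ ih ih' => exact .trans _ _ _ ih ih'

/-- The edge from which an edge after insertion arises. -/
def projEdge (r : Fin n) (f : Fin (n + 1) × Fin (n + 1)) : Fin n × Fin n :=
  (Fin.lastCases r id f.1, Fin.lastCases r id f.2)

theorem projEdge_liftTop (o' : Orientation) (f : Fin n × Fin n) :
    projEdge r (liftTop o r e o' f) = f := by
  unfold liftTop projEdge
  split_ifs with h
  · simp [← h.2.1]
  · simp

/-- The condition `o' = o ∨ f.2 ≠ Fin.last n` says that the edge is not on the new wall, the side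
shared by the new rectangle and those from `r` on. That wall is not joined to any other, and on all
other walls `projEdge` undoes the insertion. -/
theorem proj_step (D : Layout R) {o' : Orientation} {f g : Fin (n + 1) × Fin (n + 1)}
    (hq : R.IsInsPoint (o, r, e)) (h : (R.ins (o, r, e)).Next o' f g) :
    ((o' = o ∨ f.2 ≠ Fin.last n) ↔ (o' = o ∨ g.2 ≠ Fin.last n)) ∧
      ((o' = o ∨ f.2 ≠ Fin.last n) →
        Relation.EqvGen (R.Next o') (projEdge r f) (projEdge r g)) := by
  obtain ⟨a, b⟩ := f
  obtain ⟨a', b'⟩ := g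
  obtain ⟨hf, hg, h⟩ := h
  dsimp only at hf hg h ⊢
  obtain ⟨a, rfl⟩ := Fin.exists_castSucc_eq.2
    (fun h => not_ins_last_left (h ▸ hf) : a ≠ Fin.last n)
  obtain ⟨a', rfl⟩ := Fin.exists_castSucc_eq.2
    (fun h => not_ins_last_left (h ▸ hg) : a' ≠ Fin.last n)
  rcases Orientation.eq_or_eq_swap o o' with rfl | rfl
  · refine ⟨by simp, fun _ => ?_⟩
    rcases h with ⟨rfl, h⟩ | ⟨ha, h⟩
    · rw [ins_swap_castSucc] at h
      induction b using Fin.lastCases with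
      | last =>
        refine .rel _ _ ⟨?_, ?_, .inl ⟨rfl, ?_⟩⟩
        · simpa [projEdge] using (ins_last.1 hf).1
        · simpa [projEdge] using (ins_last.1 hg).1
        · simpa [projEdge] using h
      | cast b =>
        refine .rel _ _ ⟨?_, ?_, .inl ⟨rfl, ?_⟩⟩
        · simpa [projEdge] using (ins_castSucc.1 hf).1
        · simpa [projEdge] using (ins_castSucc.1 hg).1
        · simpa [projEdge] using h
    · obtain rfl := Fin.castSucc_injective _ ha
      induction b using Fin.lastCases with
      | last => exact absurd h not_ins_last_left
      | cast b =>
        induction b' using Fin.lastCases with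
        | last =>
          obtain rfl : b = r := D.eq_of_adj_of_touches _ (ins_castSucc.1 hf).1
            (ins_last.1 hg).1 (ins_swap_last.1 h).1 hq.touches
          simpa [projEdge] using Relation.EqvGen.refl _
        | cast b' =>
          refine .rel _ _ ⟨?_, ?_, .inr ⟨rfl, ?_⟩⟩
          · simpa [projEdge] using (ins_castSucc.1 hf).1
          · simpa [projEdge] using (ins_castSucc.1 hg).1
          · simpa [projEdge] using ins_swap_castSucc.1 h
  · rw [Orientation.swap_swap] at h
    simp only [Orientation.swap_ne, false_or]
    rcases h with ⟨rfl, h⟩ | ⟨ha, h⟩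
    · refine ⟨Iff.rfl, fun hb => ?_⟩
      obtain ⟨b, rfl⟩ := Fin.exists_castSucc_eq.2 hb
      refine .rel _ _ ⟨?_, ?_, .inl ⟨rfl, ?_⟩⟩
      · simpa [projEdge] using ins_swap_castSucc.1 hf
      · simpa [projEdge] using ins_swap_castSucc.1 hg
      · simpa [projEdge] using (ins_castSucc.1 h).1
    · obtain rfl := Fin.castSucc_injective _ ha
      obtain ⟨b, rfl⟩ := Fin.exists_castSucc_eq.2
        (fun hb => not_ins_last_left (hb ▸ h) : b ≠ Fin.last n)
      obtain ⟨b', rfl⟩ := Fin.exists_castSucc_eq.2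
        (fun hb => by subst hb; exact (ins_swap_last.1 hg).1 b (ins_swap_castSucc.1 hf) :
          b' ≠ Fin.last n)
      refine ⟨by simp [(Fin.castSucc_lt_last _).ne], fun hb => ?_⟩
      refine .rel _ _ ⟨?_, ?_, .inr ⟨rfl, ?_⟩⟩
      · simpa [projEdge] using ins_swap_castSucc.1 hf
      · simpa [projEdge] using ins_swap_castSucc.1 hg
      · simpa [projEdge] using (ins_castSucc.1 h).1

theorem proj_eqvGen (D : Layout R) {o' : Orientation} {f g : Fin (n + 1) × Fin (n + 1)}
    (hq : R.IsInsPoint (o, r, e)) (h : Relation.EqvGen ((R.ins (o, r, e)).Next o') f g) :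
    ((o' = o ∨ f.2 ≠ Fin.last n) ↔ (o' = o ∨ g.2 ≠ Fin.last n)) ∧
      ((o' = o ∨ f.2 ≠ Fin.last n) →
        Relation.EqvGen (R.Next o') (projEdge r f) (projEdge r g)) := by
  induction h with
  | rel _ _ h => exact proj_step D hq h
  | refl => exact ⟨Iff.rfl, fun _ => .refl _⟩
  | symm _ _ _ ih => exact ⟨ih.1.symm, fun h => .symm _ _ (ih.2 (ih.1.2 h))⟩
  | trans _ _ _ _ _ ih ih' =>
    exact ⟨ih.1.trans ih'.1, fun h => .trans _ _ _ (ih.2 h) (ih'.2 (ih.1.1 h))⟩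

theorem eqvGen_of_lift (D : Layout R) (hq : R.IsInsPoint (o, r, e)) {o' : Orientation}
    {f g : Fin n × Fin n}
    (h : Relation.EqvGen ((R.ins (o, r, e)).Next o') (liftTop o r e o' f) (liftTop o r e o' g)) :
    Relation.EqvGen (R.Next o') f g := by
  have h' := (proj_eqvGen D hq h).2
  rw [projEdge_liftTop, projEdge_liftTop] at h'
  refine h' ?_
  rcases Orientation.eq_or_eq_swap o o' with rfl | rfl
  · exact .inl rfl
  · rw [liftTop_swap]
    exact .inr (Fin.castSucc_lt_last _).ne

/-- A wall of a rectangulation as a wall after insertion at `(o, r, e)`. -/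
def liftWall (R : Adjacency n) (o : Orientation) (r : Fin n) (e : Option (Fin n))
    (o' : Orientation) (W : Set (Fin n × Fin n)) : Set (Fin (n + 1) × Fin (n + 1)) :=
  {f | ∃ g ∈ W, Relation.EqvGen ((R.ins (o, r, e)).Next o') (liftTop o r e o' g) f}

theorem liftTop_mem_liftWall {o' : Orientation} {W : Set (Fin n × Fin n)} {f : Fin n × Fin n}
    (hf : f ∈ W) : liftTop o r e o' f ∈ liftWall R o r e o' W :=
  ⟨f, hf, .refl _⟩

theorem isWall_liftWall (hN : R.IsNumbered) (D : Layout R) (hq : R.IsInsPoint (o, r, e))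
    {o' : Orientation} {W : Set (Fin n × Fin n)} (hW : R.IsWall o' W) :
    (R.ins (o, r, e)).IsWall o' (liftWall R o r e o' W) := by
  obtain ⟨f, hf, rfl⟩ := hW
  refine ⟨_, ins_liftTop hf, Set.ext fun g => ⟨?_, fun hg => ⟨f, .refl _, hg⟩⟩⟩
  rintro ⟨f', hf', hg⟩
  exact .trans _ _ _ (eqvGen_lift hN D hq hf') hg

/-- Insertion does not merge walls, since `projEdge` maps equivalent lifted edges back to equivalent
edges. This keeps the walls of a pattern distinct. -/
theorem liftWall_injective (D : Layout R) (hq : R.IsInsPoint (o, r, e))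
    {o' : Orientation} {W W' : Set (Fin n × Fin n)} (hW : R.IsWall o' W) (hW' : R.IsWall o' W')
    (h : liftWall R o r e o' W = liftWall R o r e o' W') : W = W' := by
  have key {W W' : Set (Fin n × Fin n)} (hW' : R.IsWall o' W')
      (h : liftWall R o r e o' W = liftWall R o r e o' W') : W ⊆ W' := fun f hf => by
    have hf' : liftTop o r e o' f ∈ liftWall R o r e o' W' := h ▸ liftTop_mem_liftWall hf
    obtain ⟨g, hg, hgf⟩ := hf'
    exact hW'.mem_of_eqvGen hg (eqvGen_of_lift D hq hgf)
  exact (key hW' h).antisymm (key hW h.symm)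

/-- Which part of the first edge `f` meets the end vertex depends on the case. Locating `f'` between
the two lifts of `f` is enough to transport both incidences and their order along a wall. -/
theorem endsBetween_lift (hN : R.IsNumbered) (D : Layout R) (hq : R.IsInsPoint (o, r, e))
    {o' : Orientation} {W : Set (Fin n × Fin n)} (hW : R.IsWall o' W) {x : End}
    {f g : Fin n × Fin n} (h : R.EndsBetween o' W x f g) :
    ∃ f', Relation.ReflTransGen ((R.ins (o, r, e)).Next o'.swap) (liftTop o r e o'.swap f) f' ∧
      Relation.ReflTransGen ((R.ins (o, r, e)).Next o'.swap) f' (liftBot o r e o'.swap f) ∧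
      (R.ins (o, r, e)).EndsBetween o' (liftWall R o r e o' W) x f'
        (liftTop o r e o'.swap g) := by
  obtain ⟨a, b⟩ := f
  obtain ⟨a', b'⟩ := g
  cases x with
  | first =>
    obtain ⟨hf, hg, haa, hW'⟩ := h
    obtain rfl : a = a' := haa
    have hbb := hW.edge hW'
    have hmem := liftTop_mem_liftWall (R := R) (o := o) (r := r) (e := e) (o' := o') hW'
    refine ⟨_, .refl, reflTransGen_lift hq hf, ins_liftTop hf, ins_liftTop hg, ?_⟩
    dsimp only at hf hg hbb hmem ⊢
    rcases Orientation.eq_or_eq_swap o o' with rfl | rfl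
    · rw [liftTop_swap, liftTop_swap]
      refine ⟨rfl, ?_⟩
      rw [liftTop, if_neg] at hmem
      · exact hmem
      · rintro ⟨-, h, a₀, ha₀, hlt⟩
        dsimp only at h hlt
        subst h
        exact hlt.not_ge (D.le_of_adj_top hN hf hg hbb (hq.adj ha₀))
    · rw [liftTop_swap] at hmem
      rw [Orientation.swap_swap] at hf hg ⊢
      have h₁ : ¬ (o = o ∧ (a, b).2 = r ∧ ∃ a₀ ∈ e, a₀ < (a, b).1) := by
        rintro ⟨-, h, -⟩
        dsimp only at h
        subst h
        exact hq.touches _ hbb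
      have h₂ : ¬ (o = o ∧ (a, b').2 = r ∧ ∃ a₀ ∈ e, a₀ < (a, b').1) := by
        rintro ⟨-, h, a₀, ha₀, hlt⟩
        dsimp only at h hlt
        subst h
        exact hlt.not_ge (D.le_of_adj_stem hN hf hbb hg (hq.adj ha₀))
      rw [liftTop, if_neg h₁, liftTop, if_neg h₂]
      exact ⟨rfl, hmem⟩
  | last =>
    obtain ⟨hf, hg, hbb, hW'⟩ := h
    obtain rfl : b = b' := hbb
    have haa := hW.edge hW'
    have hmem := liftTop_mem_liftWall (R := R) (o := o) (r := r) (e := e) (o' := o') hW'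
    dsimp only at hf hg haa hmem ⊢
    rcases Orientation.eq_or_eq_swap o o' with rfl | rfl
    · refine ⟨_, .refl, reflTransGen_lift hq hf, ins_liftTop hf, ins_liftTop hg, ?_⟩
      rw [liftTop_swap, liftTop_swap]
      refine ⟨rfl, ?_⟩
      rw [liftTop, if_neg] at hmem
      · exact hmem
      · rintro ⟨-, h, -⟩
        dsimp only at h
        subst h
        exact hq.touches _ hg
    · rw [liftTop_swap] at hmem
      -- Here `f` may be the split edge. The end vertex is at its lower end, so the lower half is
      -- needed.
      refine ⟨_, reflTransGen_lift hq hf, .refl, ins_liftBot hf, ins_liftTop hg, ?_⟩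
      rw [Orientation.swap_swap] at hf hg ⊢
      have hiff : (o = o ∧ (a, b).2 = r ∧ ∃ a₀ ∈ e, a₀ ≤ (a, b).1) ↔
          (o = o ∧ (a', b).2 = r ∧ ∃ a₀ ∈ e, a₀ < (a', b).1) := by
        dsimp only
        constructor
        · rintro ⟨-, hb, a₀, ha₀, hle⟩
          exact ⟨rfl, hb, a₀, ha₀, hle.trans_lt (hN.lt haa)⟩
        · rintro ⟨-, rfl, a₀, ha₀, hlt⟩
          exact ⟨rfl, rfl, a₀, ha₀, D.le_of_lt_of_adj hN hf hg (hq.adj ha₀) haa hlt⟩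
      by_cases hlt : o = o ∧ (a', b).2 = r ∧ ∃ a₀ ∈ e, a₀ < (a', b).1
      · rw [liftTop, if_pos hlt, liftBot, if_pos (hiff.2 hlt)]
        exact ⟨rfl, hmem⟩
      · rw [liftTop, if_neg hlt, liftBot, if_neg (mt hiff.1 hlt)]
        exact ⟨rfl, hmem⟩

theorem mem_liftWall_of_reflTransGen {o' : Orientation} {W : Set (Fin n × Fin n)}
    {f : Fin n × Fin n} {g : Fin (n + 1) × Fin (n + 1)} (hf : f ∈ W)
    (h : Relation.ReflTransGen ((R.ins (o, r, e)).Next o') (liftTop o r e o' f) g) :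
    g ∈ liftWall R o r e o' W :=
  ⟨f, hf, eqvGen_of_reflTransGen h⟩

theorem wallPrecedes_lift (hN : R.IsNumbered) (D : Layout R) (hq : R.IsInsPoint (o, r, e))
    {o' : Orientation} {W W' : Set (Fin n × Fin n)} (h : R.WallPrecedes o' W W') :
    (R.ins (o, r, e)).WallPrecedes o' (liftWall R o r e o' W) (liftWall R o r e o' W') := by
  refine Relation.TransGen.lift (liftWall R o r e o') ?_ _ _ h
  rintro V V' ⟨hV, hV', a, b, c, hab, hbc⟩
  refine ⟨isWall_liftWall hN D hq hV, isWall_liftWall hN D hq hV', ?_⟩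
  have hab' := hV.edge hab
  have hbc' := hV'.edge hbc
  have h₁ := liftTop_mem_liftWall (R := R) (o := o) (r := r) (e := e) (o' := o') hab
  have h₂ := liftTop_mem_liftWall (R := R) (o := o) (r := r) (e := e) (o' := o') hbc
  dsimp only at hab' hbc'
  obtain ⟨z, hz⟩ : ∃ z, liftTop o r e o' (b, c) = (b.castSucc, z) := by
    unfold liftTop
    split_ifs <;> exact ⟨_, rfl⟩
  rw [hz] at h₂
  by_cases h : o' = o ∧ b = r ∧ ∃ a₀ ∈ e, a₀ < a
  -- The edge `(a, r)` now borders the new rectangle instead of `r`. Its wall also contains `(a₀,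
  -- r)`, whose upper half still borders `r`, so `r` can still be crossed.
  · obtain ⟨rfl, rfl, a₀, ha₀, -⟩ := h
    have h₃ := hV.mem_of_eqvGen hab (D.eqvGen_next hN hab' (hq.adj ha₀))
    have h₄ := liftTop_mem_liftWall (R := R) (o := o') (r := b) (e := e) (o' := o') h₃
    rw [liftTop, if_neg] at h₄
    · exact ⟨_, _, _, h₄, h₂⟩
    · rintro ⟨-, -, a₁, ha₁, hlt⟩
      rw [Option.mem_unique ha₁ ha₀] at hlt
      exact lt_irrefl _ hlt
  · rw [liftTop, if_neg h] at h₁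
    exact ⟨_, _, _, h₁, h₂⟩

/-- Holds for every pattern and every insertion point. Tameness enters only for the opposite
question, whether an insertion creates a pattern. -/
theorem contains_ins (hN : R.IsNumbered) (D : Layout R) {q : InsPoint n} (hq : R.IsInsPoint q)
    {P : Pattern} (h : Contains R P) : Contains (R.ins q) P := by
  obtain ⟨o, r, e⟩ := q
  obtain ⟨φ, hwall, hinj, hinc, hord, hpos⟩ := h
  refine ⟨fun w => liftWall R o r e (P.ori w) (φ w), fun w => isWall_liftWall hN D hq (hwall w),
    ?_, ?_, ?_, ?_⟩
  · intro w w' ho h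
    refine hinj w w' ho (liftWall_injective D hq (hwall w) (ho ▸ hwall w') ?_)
    dsimp only at h
    rw [h, ho]
  · intro w x v hw
    obtain ⟨ho, f, hf, g, hg, hfg⟩ := hinc w x v hw
    obtain ⟨f', h₁, -, h₃⟩ := endsBetween_lift hN D hq (hwall w) hfg
    rw [← ho] at h₁ h₃
    exact ⟨ho, f', mem_liftWall_of_reflTransGen hf h₁, _, liftTop_mem_liftWall hg, h₃⟩
  · intro v w x w' x' hv
    obtain ⟨ho, ho', f, hf, g, hg, f', hf', g', hg', hfg, hfg', hff⟩ := hord v w x w' x' hv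
    obtain ⟨k, h₁, h₂, h₃⟩ := endsBetween_lift hN D hq (hwall w) hfg
    obtain ⟨k', h₁', h₂', h₃'⟩ := endsBetween_lift hN D hq (hwall w') hfg'
    rw [← ho] at h₁ h₂ h₃
    rw [← ho'] at h₁' h₂' h₃'
    exact ⟨ho, ho', k, mem_liftWall_of_reflTransGen hf h₁, _, liftTop_mem_liftWall hg,
      k', mem_liftWall_of_reflTransGen hf' h₁', _, liftTop_mem_liftWall hg', h₃, h₃',
      ((transGen_lift hN D hq hff).trans_right h₂).trans_left h₁'⟩
  · intro w w' hw
    obtain ⟨ho, h⟩ := hpos w w' hw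
    refine ⟨ho, ?_⟩
    have := wallPrecedes_lift hN D hq h
    dsimp only
    rwa [← ho]

end Lift

/-! ### Zigzag sets of avoiding rectangulations -/

theorem square_mem : square ∈ 𝓡 1 := by
  refine ⟨⟨fun o b h => h, trivial⟩,
    { outer := ⟨0, 1, 0, 1, one_pos, one_pos⟩
      box := fun _ => ⟨0, 1, 0, 1, one_pos, one_pos⟩
      cover := Set.iUnion_const _
      disjoint := fun i j hij => absurd (Subsingleton.elim i j) hij
      generic := fun p s _ => s.card_le_univ.trans (by simp) }, ?_⟩
  funext o a b
  cases o <;> simp [Drawing.adjacency, Box.LeftOf, Box.AboveOf, square]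

theorem not_contains_square (P : Pattern) : ¬ Contains square P := by
  rintro ⟨φ, h, -⟩
  obtain ⟨e, he, -⟩ := h ⟨0, P.size_pos⟩
  exact he

theorem IsZigzag.subset : ∀ {n : ℕ} {C : Set (Adjacency n)}, IsZigzag C → C ⊆ 𝓡 n
  | 0, _, h => h.elim
  | 1, C, h => by
    rw [show C = {square} from h]
    exact Set.singleton_subset_iff.2 square_mem
  | _ + 2, _, h => h.1

theorem IsZigzag.del {n : ℕ} {C : Set (Adjacency (n + 2))} (h : IsZigzag C) :
    IsZigzag (Adjacency.del '' C) := h.2.1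

theorem IsZigzag.exists_corner {n : ℕ} {C : Set (Adjacency (n + 2))} (h : IsZigzag C)
    {R : Adjacency (n + 1)} (hR : R ∈ Adjacency.del '' C) (o : Orientation) :
    ∃ S ∈ C, R.IsChild (R.cornerIndex o) S := by
  cases o
  exacts [(h.2.2 R hR).1, (h.2.2 R hR).2]

theorem IsZigzag.pos {n : ℕ} {C : Set (Adjacency n)} (h : IsZigzag C) : 0 < n := by
  cases n with
  | zero => exact h.elim
  | succ n => exact n.succ_pos

theorem del_of_isChild {n : ℕ} {R : Adjacency n} (hR : R ∈ 𝓡 n) {k : ℕ} {S : Adjacency (n + 1)}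
    (h : R.IsChild k S) : S.del = R := by
  obtain ⟨q, hq, rfl⟩ := h
  obtain ⟨D⟩ := nonempty_layout_of_mem hR
  exact del_ins hR.1 D hq.1

theorem AvoidsAll.del {n : ℕ} [NeZero n] {𝒬 : Finset Pattern} {S : Adjacency (n + 1)}
    (hS : S ∈ 𝓡 (n + 1)) (hR : S.del ∈ 𝓡 n) (h : AvoidsAll 𝒬 S) : AvoidsAll 𝒬 S.del := by
  intro P hP hc
  obtain ⟨D⟩ := nonempty_layout_of_mem hS
  obtain ⟨D'⟩ := nonempty_layout_of_mem hR
  obtain ⟨q, hq, heq⟩ := exists_eq_ins hS.1 D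
  refine h P hP ?_
  rw [heq]
  exact contains_ins hR.1 D' hq hc

theorem AvoidsAll.corner {n : ℕ} [NeZero n] {𝒬 : Finset Pattern} (h𝒬 : ∀ P ∈ 𝒬, Tame P)
    {R : Adjacency n} (hR : R ∈ 𝓡 n) (h : AvoidsAll 𝒬 R) {o : Orientation}
    {S : Adjacency (n + 1)} (hS : R.IsChild (R.cornerIndex o) S) : AvoidsAll 𝒬 S := by
  intro P hP
  have ht := h𝒬 P hP n (NeZero.one_le) R hR (h P hP)
  cases o
  exacts [ht.1 S hS, ht.2 S hS]

/-- One inclusion holds because deletion preserves avoidance. For the other, the corner child of an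
avoider lies in `C` by the zigzag property and avoids by tameness. -/
theorem del_image_avoiders {𝒬 : Finset Pattern} (h𝒬 : ∀ P ∈ 𝒬, Tame P) {n : ℕ}
    {C : Set (Adjacency (n + 2))} (hC : IsZigzag C) :
    Adjacency.del '' avoiders C 𝒬 = avoiders (Adjacency.del '' C) 𝒬 := by
  ext R
  constructor
  · rintro ⟨S, ⟨hS, hav⟩, rfl⟩
    have hR := Set.mem_image_of_mem Adjacency.del hS
    exact ⟨hR, hav.del (hC.subset hS) (hC.del.subset hR)⟩
  · rintro ⟨hR, hav⟩
    obtain ⟨S, hS, hRS⟩ := hC.exists_corner hR .vertical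
    exact ⟨S, ⟨hS, hav.corner h𝒬 (hC.del.subset hR) hRS⟩, del_of_isChild (hC.del.subset hR) hRS⟩

theorem isZigzag_avoiders {𝒬 : Finset Pattern} (h𝒬 : ∀ P ∈ 𝒬, Tame P) :
    ∀ {n : ℕ} {C : Set (Adjacency n)}, IsZigzag C → IsZigzag (avoiders C 𝒬)
  | 0, _, h => h.elim
  | 1, C, h => by
    obtain rfl : C = {square} := h
    exact Set.sep_eq_self_iff_mem_true.2 fun R hR P _ => by
      rw [Set.mem_singleton_iff.1 hR]
      exact not_contains_square P
  | n + 2, C, h => by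
    refine ⟨fun S hS => h.subset hS.1, ?_, fun R hR => ?_⟩
    · rw [del_image_avoiders h𝒬 h]
      exact isZigzag_avoiders h𝒬 h.del
    · rw [del_image_avoiders h𝒬 h] at hR
      have key (o : Orientation) : ∃ S ∈ avoiders C 𝒬, R.IsChild (R.cornerIndex o) S := by
        obtain ⟨S, hS, hRS⟩ := h.exists_corner hR.1 o
        exact ⟨S, ⟨hS, hR.2.corner h𝒬 (h.del.subset hR.1) hRS⟩, hRS⟩
      exact ⟨key .vertical, key .horizontal⟩

/-! ### Jumps -/

/-- `k'` is the index reached from the index `k` by `d` steps. -/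
def Dir.Reaches : Dir → ℕ → ℕ → ℕ → Prop
  | .right, d, k, k' => k' = k + d
  | .left, d, k, k' => k = k' + d

theorem isJump_succ {dir : Dir} {j d n : ℕ} {R R' : Adjacency (n + 1)} :
    IsJump dir j d R R' ↔
      (j = n + 1 ∧ 2 ≤ j ∧ 0 < d ∧ R.del = R'.del ∧
        ∃ k k' : ℕ, R.del.IsChild k R ∧ R.del.IsChild k' R' ∧ dir.Reaches d k k') ∨
      (j < n + 1 ∧ (∃ o, R.Based o ∧ R'.Based o) ∧ IsJump dir j d R.del R'.del) := by
  rw [IsJump]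
  refine or_congr ?_ (and_congr_right fun _ => and_congr_left fun _ => ?_)
  · cases dir <;> rfl
  · constructor
    · rintro (h | h)
      exacts [⟨.vertical, h⟩, ⟨.horizontal, h⟩]
    · rintro ⟨_ | _, h⟩
      exacts [.inl h, .inr h]

theorem not_isJump_one {dir : Dir} {j d : ℕ} {R R' : Adjacency 1} : ¬ IsJump dir j d R R' := by
  rw [isJump_succ]
  rintro (⟨h, h', -⟩ | ⟨-, -, h⟩)
  · omega
  · exact h

theorem IsZigzag.based_unique {n : ℕ} {C : Set (Adjacency (n + 2))} (hC : IsZigzag C)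
    {R : Adjacency (n + 2)} (hR : R ∈ C) {o o' : Orientation} (h : R.Based o) (h' : R.Based o') :
    o' = o := by
  obtain ⟨D⟩ := nonempty_layout_of_mem (hC.subset hR)
  refine (Orientation.eq_or_eq_swap o o').resolve_right ?_
  rintro rfl
  exact h.not_swap (hC.subset hR).1 D h'

theorem IsZigzag.isChild_of_based {n : ℕ} {C : Set (Adjacency (n + 2))} (hC : IsZigzag C)
    {R : Adjacency (n + 2)} (hR : R ∈ C) {o : Orientation} (h : R.Based o) :
    R.del.IsChild (R.del.cornerIndex o) R := by
  obtain ⟨D⟩ := nonempty_layout_of_mem (hC.subset hR)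
  obtain ⟨D'⟩ := nonempty_layout_of_mem (hC.del.subset (Set.mem_image_of_mem _ hR))
  exact isChild_cornerIndex_of_based (hC.subset hR).1 D D' h

theorem IsJump.pos {dir : Dir} {j d : ℕ} : ∀ {n : ℕ} {R R' : Adjacency n},
    IsJump dir j d R R' → 0 < d
  | 0, _, _, h => h.elim
  | n + 1, _, _, h => by
    rcases isJump_succ.1 h with h | ⟨-, -, h⟩
    exacts [h.2.2.1, h.pos]

/-- For jumps of earlier rectangles, both jumps must share the orientation of the base: with at
least two rectangles the middle rectangulation cannot be both bottom-based and right-based. -/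
theorem IsJump.trans {dir : Dir} {j d d' : ℕ} : ∀ {n : ℕ} {C : Set (Adjacency n)}
    {R R₁ R₂ : Adjacency n}, IsZigzag C → R₁ ∈ C →
    IsJump dir j d R R₁ → IsJump dir j d' R₁ R₂ → IsJump dir j (d + d') R R₂
  | 0, _, _, _, _, hC, _, _, _ => hC.elim
  | 1, _, _, _, _, _, _, h, _ => absurd h not_isJump_one
  | n + 2, C, R, R₁, R₂, hC, hR₁, h, h' => by
    rw [isJump_succ] at h h' ⊢
    rcases h with ⟨hj, hj2, hd, hdel, k, k₁, hk, hk₁, hs⟩ | ⟨hj, ⟨o, ho⟩, h⟩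
    · rcases h' with ⟨-, -, hd', hdel', k₁', k₂, hk₁', hk₂, hs'⟩ | ⟨hj', -⟩
      · rw [← hdel] at hk₁' hk₂
        obtain rfl := hk₁.index_unique hk₁'
        refine .inl ⟨hj, hj2, by omega, hdel.trans hdel', k, k₂, hk, hk₂, ?_⟩
        cases dir <;> simp only [Dir.Reaches] at * <;> omega
      · omega
    · rcases h' with ⟨hj', -⟩ | ⟨-, ⟨o', ho'⟩, h'⟩
      · omega
      · obtain rfl := hC.based_unique hR₁ ho.2 ho'.1
        exact .inr ⟨hj, ⟨o', ho.1, ho'.2⟩, h.trans hC.del (Set.mem_image_of_mem _ hR₁) h'⟩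

/-- For an earlier rectangle the parents of the targets agree by induction, and both targets are the
corner child of that parent on the same side. -/
theorem IsJump.unique {dir : Dir} {j d : ℕ} : ∀ {n : ℕ} {C : Set (Adjacency n)}
    {R R₁ R₂ : Adjacency n}, IsZigzag C → R ∈ C → R₁ ∈ C → R₂ ∈ C →
    IsJump dir j d R R₁ → IsJump dir j d R R₂ → R₁ = R₂
  | 0, _, _, _, _, hC, _, _, _, _, _ => hC.elim
  | 1, _, _, _, _, _, _, _, _, h, _ => absurd h not_isJump_one
  | n + 2, C, R, R₁, R₂, hC, hR, hR₁, hR₂, h, h' => by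
    rw [isJump_succ] at h h'
    rcases h with ⟨hj, -, -, -, k, k₁, hk, hk₁, hs⟩ | ⟨hj, ⟨o, ho⟩, h⟩
    · rcases h' with ⟨-, -, -, -, k', k₂, hk', hk₂, hs'⟩ | ⟨hj', -⟩
      · obtain rfl := hk.index_unique hk'
        obtain rfl : k₁ = k₂ := by cases dir <;> simp only [Dir.Reaches] at * <;> omega
        exact hk₁.unique hk₂
      · omega
    · rcases h' with ⟨hj', -⟩ | ⟨-, ⟨o', ho'⟩, h'⟩
      · omega
      · obtain rfl := hC.based_unique hR ho.1 ho'.1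
        have h₁ := hC.isChild_of_based hR₁ ho.2
        have h₂ := hC.isChild_of_based hR₂ ho'.2
        rw [h.unique hC.del (Set.mem_image_of_mem _ hR) (Set.mem_image_of_mem _ hR₁)
          (Set.mem_image_of_mem _ hR₂) h'] at h₁
        exact h₁.unique h₂

/-- Lets a target beyond `R₁` be viewed as a jump from `R₁`, where minimality of the given oracle
applies. -/
theorem IsJump.sub {dir : Dir} {j d d' : ℕ} (hdd : d < d') : ∀ {n : ℕ} {C : Set (Adjacency n)}
    {R R₁ R₂ : Adjacency n}, IsZigzag C → R ∈ C →
    IsJump dir j d R R₁ → IsJump dir j d' R R₂ → IsJump dir j (d' - d) R₁ R₂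
  | 0, _, _, _, _, hC, _, _, _ => hC.elim
  | 1, _, _, _, _, _, _, h, _ => absurd h not_isJump_one
  | n + 2, C, R, R₁, R₂, hC, hR, h, h' => by
    rw [isJump_succ] at h h' ⊢
    rcases h with ⟨hj, hj2, hd, hdel, k, k₁, hk, hk₁, hs⟩ | ⟨hj, ⟨o, ho⟩, h⟩
    · rcases h' with ⟨-, -, hd', hdel', k', k₂, hk', hk₂, hs'⟩ | ⟨hj', -⟩
      · obtain rfl := hk.index_unique hk'
        rw [hdel] at hk₁ hk₂
        refine .inl ⟨hj, hj2, by omega, hdel.symm.trans hdel', k₁, k₂, hk₁, hk₂, ?_⟩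
        cases dir <;> simp only [Dir.Reaches] at * <;> omega
      · omega
    · rcases h' with ⟨hj', -⟩ | ⟨-, ⟨o', ho'⟩, h'⟩
      · omega
      · obtain rfl := hC.based_unique hR ho.1 ho'.1
        exact .inr ⟨hj, ⟨o', ho.2, ho'.2⟩, h.sub hdd hC.del (Set.mem_image_of_mem _ hR) h'⟩

theorem IsJump.le {dir : Dir} {j d : ℕ} : ∀ {n : ℕ} {C : Set (Adjacency n)}
    {R R' : Adjacency n}, IsZigzag C → R ∈ C → IsJump dir j d R R' → d ≤ 2 * n
  | 0, _, _, _, hC, _, _ => hC.elim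
  | 1, _, _, _, _, _, h => absurd h not_isJump_one
  | n + 2, C, R, R', hC, hR, h => by
    have hdel := Set.mem_image_of_mem Adjacency.del hR
    rcases isJump_succ.1 h with ⟨-, -, -, -, k, k', hk, hk', hs⟩ | ⟨-, -, h⟩
    · obtain ⟨D⟩ := nonempty_layout_of_mem (hC.del.subset hdel)
      have h₁ := nu_le (hC.del.subset hdel).1 D
      have h₂ := hk.one_le
      have h₃ := hk'.one_le
      have h₄ := hk.le_nu
      have h₅ := hk'.le_nu
      cases dir <;> simp only [Dir.Reaches] at hs <;> omega
    · have := h.le hC.del hdel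
      omega

/-- A jump from an avoiding rectangulation to one that contains a pattern can be continued. -/
theorem IsJump.exists_next {𝒬 : Finset Pattern} (h𝒬 : ∀ P ∈ 𝒬, Tame P) {dir : Dir} {j d : ℕ} :
    ∀ {n : ℕ} {C : Set (Adjacency n)} {R R' : Adjacency n}, IsZigzag C → R ∈ avoiders C 𝒬 →
    R' ∈ C → IsJump dir j d R R' → ¬ AvoidsAll 𝒬 R' → ∃ d', ∃ S ∈ C, IsJump dir j d' R' S
  | 0, _, _, _, hC, _, _, _, _ => hC.elim
  | 1, _, _, _, _, _, _, h, _ => absurd h not_isJump_one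
  | n + 2, C, R, R', hC, hR, hR', h, hav => by
    have hRdel : R.del ∈ avoiders (Adjacency.del '' C) 𝒬 := by
      rw [← del_image_avoiders h𝒬 hC]
      exact Set.mem_image_of_mem _ hR
    rw [isJump_succ] at h
    rcases h with ⟨hj, hj2, hd, hdel, k, k', hk, hk', hs⟩ | ⟨hj, ⟨o, ho⟩, h⟩
    -- The common parent avoids all patterns, so by tameness a corner child would avoid them too.
    · have hne (o) : k' ≠ R.del.cornerIndex o := by
        rintro rfl
        exact hav (hRdel.2.corner h𝒬 (hC.del.subset hRdel.1) hk')
      obtain ⟨o, hlt⟩ : ∃ o, ∃ d', 0 < d' ∧ dir.Reaches d' k' (R.del.cornerIndex o) := by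
        cases dir with
        | left =>
          have := lt_of_le_of_ne hk'.one_le (hne .vertical).symm
          exact ⟨.vertical, k' - 1, by omega, by simp only [Dir.Reaches, cornerIndex]; omega⟩
        | right =>
          have := lt_of_le_of_ne hk'.le_nu (hne .horizontal)
          exact ⟨.horizontal, R.del.nu - k', by omega, by
            simp only [Dir.Reaches, cornerIndex]; omega⟩
      obtain ⟨d', hd', hreach⟩ := hlt
      obtain ⟨S, hS, hRS⟩ := hC.exists_corner hRdel.1 o
      refine ⟨d', S, hS, isJump_succ.2 (.inl ⟨hj, hj2, hd', ?_, k', _, ?_, ?_, hreach⟩)⟩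
      · rw [← hdel, del_of_isChild (hC.del.subset hRdel.1) hRS]
      · rwa [← hdel]
      · rwa [← hdel]
    · have hR'del := Set.mem_image_of_mem Adjacency.del hR'
      -- `R'` is a corner child of its parent, so by tameness the pattern must already occur in the
      -- parent, and induction yields a further jump there. Reinsertion at the same corner stays in
      -- `C` and keeps the base.
      have hav' : ¬ AvoidsAll 𝒬 R'.del := fun hav' =>
        hav (hav'.corner h𝒬 (hC.del.subset hR'del) (hC.isChild_of_based hR' ho.2))
      obtain ⟨d', S, hS, hjump⟩ := h.exists_next h𝒬 hC.del hRdel hR'del hav'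
      obtain ⟨S', hS', hSS'⟩ := hC.exists_corner hS o
      have hdel := del_of_isChild (hC.del.subset hS) hSS'
      obtain ⟨D⟩ := nonempty_layout_of_mem (hC.del.subset hS)
      refine ⟨d', S', hS', isJump_succ.2 (.inr ⟨hj, ⟨o, ho.2, ?_⟩, by rwa [hdel]⟩)⟩
      exact based_of_isChild_cornerIndex (hC.del.subset hS).1 D hSS'

/-! ### Running time -/

section Programs

variable {n : ℕ} {C : Set (Adjacency n)} {enc : DataStructure n} {base : Prog}
  {test : Pattern → Prog} {f t j : ℕ} {dir : Dir} {𝒬 : Finset Pattern}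

theorem Exec.pos {p : Prog} {σ σ' : State} {k : ℕ} (h : Exec j dir p σ σ' k) : 0 < k := by
  induction h <;> omega

/-- Each test costs `t`, plus one step for the branch and one for a possible `skip`; the final `+ 1`
is the assignment that ends an empty list. -/
theorem exec_testAny (htest : ∀ P ∈ 𝒬, IsContainmentTest enc C 𝒬 P (test P) t)
    {R : Adjacency n} (hR : R ∈ C) (hjump : ∃ R₀ ∈ avoiders C 𝒬, ∃ d, IsJump dir j d R₀ R)
    (L : List Pattern) (hL : ∀ P ∈ L, P ∈ 𝒬) (σ : State) (hσ : σ.heap ∈ enc R) :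
    ∃ (σ' : State) (k : ℕ), Exec j dir (testAny (L.map test)) σ σ' k ∧
      k ≤ L.length * (t + 2) + 1 ∧ σ'.heap ∈ enc R ∧ (σ'.reg 0 ≠ 0 ↔ ∃ P ∈ L, Contains R P) := by
  induction L generalizing σ with
  | nil => exact ⟨_, 1, .const _ _ _, by simp, hσ, by simp⟩
  | cons P L ih =>
    rw [List.forall_mem_cons] at hL
    obtain ⟨σ₁, k₁, hexec₁, hk₁, hσ₁, hP⟩ := htest P hL.1 R hR j dir hjump σ hσ
    rw [List.length_cons, add_mul, one_mul]
    by_cases h : Contains R P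
    · refine ⟨σ₁, k₁ + (1 + 1), .seq hexec₁ (.ite_true (hP.2 h) (.skip _)), by omega, hσ₁, ?_⟩
      simp [hP.2 h, h]
    · obtain ⟨σ₂, k₂, hexec₂, hk₂, hσ₂, hP₂⟩ := ih hL.2 σ₁ hσ₁
      refine ⟨σ₂, k₁ + (k₂ + 1), .seq hexec₁ (.ite_false (not_ne_iff.1 (mt hP.1 h)) hexec₂),
        by omega, hσ₂, ?_⟩
      simp [hP₂, h]

/-- Loop invariant: the current `R₁` is reached from `R` by a jump of `d` steps that skips no
avoider. The fuel `m` bounds the remaining iterations, because `d` grows each time and never exceeds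
`2 * n`. -/
theorem exec_loop (h𝒬 : ∀ P ∈ 𝒬, Tame P) (hC : IsZigzag C)
    (hbase : IsMinimalJumpOracle enc C base f)
    (htest : ∀ P ∈ 𝒬, IsContainmentTest enc C 𝒬 P (test P) t)
    {R : Adjacency n} (hR : R ∈ avoiders C 𝒬) (m : ℕ) {d : ℕ} {R₁ : Adjacency n} (hR₁ : R₁ ∈ C)
    (hjump : IsJump dir j d R R₁) (hm : 2 * n ≤ d + m)
    (hmin : ∀ d' < d, ∀ R'' ∈ avoiders C 𝒬, ¬ IsJump dir j d' R R'') {σ : State}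
    (hσ : σ.heap ∈ enc R₁) (hreg : σ.reg 0 ≠ 0 ↔ ¬ AvoidsAll 𝒬 R₁) :
    ∃ (σ' : State) (k : ℕ),
      Exec j dir (.while 0 (.seq base (testAny (𝒬.toList.map test)))) σ σ' k ∧
      k ≤ m * (f + (𝒬.card * (t + 2) + 1) + 1) + 1 ∧
      ∃ R', IsMinimalJump (avoiders C 𝒬) dir j R R' ∧ σ'.heap ∈ enc R' := by
  induction m generalizing d R₁ σ with
  | zero =>
    by_cases hav : AvoidsAll 𝒬 R₁
    · exact ⟨σ, 1, .while_false (not_ne_iff.1 (mt hreg.1 (not_not_intro hav))), by omega, R₁,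
        ⟨⟨hR₁, hav⟩, d, hjump, hmin⟩, hσ⟩
    · obtain ⟨d', S, hS, hjump'⟩ := hjump.exists_next h𝒬 hC hR hR₁ hav
      -- Without fuel, `d` is already at least `2 * n`, so a further jump would exceed the bound.
      have := (hjump.trans hC hR₁ hjump').le hC hR.1
      have := hjump'.pos
      omega
  | succ m ih =>
    by_cases hav : AvoidsAll 𝒬 R₁
    · exact ⟨σ, 1, .while_false (not_ne_iff.1 (mt hreg.1 (not_not_intro hav))), by omega, R₁,
        ⟨⟨hR₁, hav⟩, d, hjump, hmin⟩, hσ⟩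
    · obtain ⟨d', S, hS, hjump'⟩ := hjump.exists_next h𝒬 hC hR hR₁ hav
      obtain ⟨σ₁, k₁, hexec₁, hk₁, R₂, ⟨hR₂, d₂, hjump₂, hmin₂⟩, hσ₁⟩ :=
        hbase R₁ hR₁ j dir ⟨d', S, hC.subset hS, hjump'⟩ σ hσ
      have hjump₂' := hjump.trans hC hR₁ hjump₂
      obtain ⟨σ₂, k₂, hexec₂, hk₂, hσ₂, hreg₂⟩ := exec_testAny htest hR₂ ⟨R, hR, _, hjump₂'⟩
        𝒬.toList (fun P hP => Finset.mem_toList.1 hP) σ₁ hσ₁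
      obtain ⟨σ₃, k₃, hexec₃, hk₃, hfinal⟩ := ih hR₂ hjump₂' (by have := hjump₂.pos; omega)
        -- No avoider is skipped: fewer than `d` steps are covered by the invariant, exactly `d`
        -- steps lead to `R₁`, which contains a pattern, and more steps would contradict minimality
        -- of the jump from `R₁`.
        (fun d'' hd'' R'' hR'' hj'' => by
          rcases lt_trichotomy d'' d with hlt | rfl | hlt
          · exact hmin d'' hlt R'' hR'' hj''
          · rw [hjump.unique hC hR.1 hR₁ hR''.1 hj''] at hav
            exact hav hR''.2
          · exact hmin₂ (d'' - d) (by omega) R'' hR''.1 (hjump.sub hlt hC hR.1 hj''))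
        hσ₂ (by simpa [AvoidsAll] using hreg₂)
      refine ⟨σ₃, _, .while_true (hreg.2 hav) (.seq hexec₁ hexec₂) hexec₃, ?_, hfinal⟩
      rw [Finset.length_toList] at hk₂
      rw [add_mul, one_mul]
      omega

theorem isMinimalJumpOracle_avoiders (h𝒬 : ∀ P ∈ 𝒬, Tame P) (hC : IsZigzag C)
    (hbase : IsMinimalJumpOracle enc C base f)
    (htest : ∀ P ∈ 𝒬, IsContainmentTest enc C 𝒬 P (test P) t) :
    IsMinimalJumpOracle enc (avoiders C 𝒬) (nextJumpAvoiding base (𝒬.toList.map test))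
      (12 * (𝒬.card + 1) * (n * (f + t))) := by
  intro R hR j dir hcan σ hσ
  obtain ⟨σ₁, k₁, hexec₁, hk₁, R₁, ⟨hR₁, d₁, hjump₁, hmin₁⟩, hσ₁⟩ := hbase R hR.1 j dir hcan σ hσ
  obtain ⟨σ₂, k₂, hexec₂, hk₂, hσ₂, hreg₂⟩ := exec_testAny htest hR₁ ⟨R, hR, _, hjump₁⟩
    𝒬.toList (fun P hP => Finset.mem_toList.1 hP) σ₁ hσ₁
  obtain ⟨σ₃, k₃, hexec₃, hk₃, hfinal⟩ := exec_loop h𝒬 hC hbase htest hR (2 * n) hR₁ hjump₁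
    (by omega) (fun d' hd' R'' hR'' => hmin₁ d' hd' R'' hR''.1) hσ₂
    (by simpa [AvoidsAll] using hreg₂)
  refine ⟨σ₃, _, .seq hexec₁ (.seq hexec₂ hexec₃), ?_, hfinal⟩
  rw [Finset.length_toList] at hk₂
  -- Every execution takes at least one step, so the additive constants can be absorbed into
  -- multiples of `f`.
  have hf : 1 ≤ f := hexec₁.pos.trans_le hk₁
  have hn : 1 ≤ n := hC.pos
  set B := f + (𝒬.card * (t + 2) + 1) + 1 with hB
  have hB' : B ≤ 3 * (𝒬.card + 1) * (f + t) := by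
    have : 𝒬.card ≤ 𝒬.card * f := Nat.le_mul_of_pos_right _ hf
    rw [hB]
    nlinarith
  -- The initial call and its tests count as one more round besides the at most `2 * n` loop
  -- iterations; `2 * n + 1 ≤ 4 * n` then gives the factor `4 * 3 = 12`.
  calc k₁ + (k₂ + k₃) ≤ (2 * n + 1) * B := by rw [add_mul, one_mul]; omega
    _ ≤ (4 * n) * (3 * (𝒬.card + 1) * (f + t)) := Nat.mul_le_mul (by omega) hB'
    _ = 12 * (𝒬.card + 1) * (n * (f + t)) := by ring

end Programs

end GenRect

open GenRect
theorem mainTheorem8 (𝒬 : Finset Pattern) (h𝒬 : ∀ P ∈ 𝒬, Tame P) :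
    ∃ c : ℕ, ∀ (n : ℕ) (C : Set (Adjacency n)) (enc : DataStructure n)
      (base : Prog) (test : Pattern → Prog) (f t : ℕ),
      IsZigzag C →
      IsMinimalJumpOracle enc C base f →
      (∀ P ∈ 𝒬, IsContainmentTest enc C 𝒬 P (test P) t) →
      IsZigzag (avoiders C 𝒬) ∧
      IsMinimalJumpOracle enc (avoiders C 𝒬) (nextJumpAvoiding base (𝒬.toList.map test))
        (c * (n * (f + t))) :=
  ⟨12 * (𝒬.card + 1), fun _ _ _ _ _ _ _ hC hbase htest =>
    ⟨isZigzag_avoiders h𝒬 hC, isMinimalJumpOracle_avoiders h𝒬 hC hbase htest⟩⟩
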